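/- Let $p>3$ be a prime and let $w$ be a generator of $\mathbb{F}_p^{*}$. Write $[a,b]=a^{-1}b^{-1}ab$. In the presentations below every commutator $[x_j,x_i]$ ($i<j$) of two generators and every $p$-th power $x_i^p$ of a generator that is not listed is understood to be $1$; exponents in $\mathbb{F}_p$ are read through representatives in $\{0,\dots,p-1\}$. For a finite $p$-group $X$ let $\gamma_0(X)=X$ and $\gamma_{i+1}(X)=\langle [h,g]k^p \mid h,k\in\gamma_i(X),\ g\in X\rangle$; the $p$-class of $X$ is the least $c$ with $\gamma_c(X)=1$. If $G$ is a finite $p$-group of $p$-class $c$, a finite $p$-group $H$ is an immediate descendant of $G$ if $H$ has the same minimal number of generators as $G$, $H/\gamma_c(H)\cong G$, and $H$ has $p$-class $c+1$. Let $D_p=\langle a_1,a_2,a_3\mid [a_2,a_1]=a_3\rangle$ (the Heisenberg group of order $p^3$). Then the following groups, each generated by $h_1,\dots,h_5$ and each having the relation $[h_2,h_1]=h_3$ in addition to those displayed, are immediate descendants of $D_p$ of order $p^5$, they are pairwise non-isomorphic, and every immediate descendant of $D_p$ of order $p^5$ is isomorphic to one of them: - $H_1$: $[h_3,h_1]=h_4,\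 [h_3,h_2]=h_5$; - $H_2$: $[h_3,h_1]=h_4,\ [h_3,h_2]=h_5,\ h_2^p=h_5$; - $H_3$: $[h_3,h_1]=h_4,\ [h_3,h_2]=h_5,\ h_2^p=h_4$; - $H_4$: $[h_3,h_1]=h_4,\ [h_3,h_2]=h_5,\ h_2^p=h_4^{w}$; - $H_5$: $[h_3,h_1]=h_4,\ [h_3,h_2]=h_5,\ h_1^p=h_4,\ h_2^p=h_5$; - $H_6$: $[h_3,h_1]=h_4h_5,\ [h_3,h_2]=h_5,\ h_1^p=h_4,\ h_2^p=h_5$; - $H_7$: $[h_3,h_1]=h_4h_5^{w},\ [h_3,h_2]=h_5,\ h_1^p=h_4,\ h_2^p=h_5$; - $H_8$: $[h_3,h_1]=h_5^{w},\ [h_3,h_2]=h_4,\ h_1^p=h_4,\ h_2^p=h_5$; - $H_9^k$ for $1\le k\le\frac{p-1}{2}$: $[h_3,h_1]=h_4,\ [h_3,h_2]=h_5^{w^k},\ h_1^p=h_4,\ h_2^p=h_5$; - $H_{10}^k$ for $0\le k\le\frac{p-1}{2}-1$: $[h_3,h_1]=h_4h_5^{w^{k+1}},\ [h_3,h_2]=h_4^{w^k}h_5,\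 h_1^p=h_4,\ h_2^p=h_5$. In particular $D_p$ has exactly $p+7$ isomorphism classes of immediate descendants of order $p^5$. Moreover, let $GL(2,p)$ act on the $2\times2$ matrices over $\mathbb{F}_p$ by $(g,m)\mapsto \det(g)\,g^{-1}mg$. This action has exactly $p+7$ orbits, and a system of representatives is given by $$\begin{pmatrix}0&0\\0&0\end{pmatrix},\ \begin{pmatrix}0&0\\0&1\end{pmatrix},\ \begin{pmatrix}0&1\\0&0\end{pmatrix},\ \begin{pmatrix}0&w\\0&0\end{pmatrix},\ \begin{pmatrix}1&0\\0&1\end{pmatrix},\ \begin{pmatrix}1&1\\0&1\end{pmatrix},\ \begin{pmatrix}1&w\\0&1\end{pmatrix},\ \begin{pmatrix}0&w\\1&0\end{pmatrix},\ \begin{pmatrix}1&0\\0&w^k\end{pmatrix},\ \begin{pmatrix}1&w^{k+1}\\w^k&1\end{pmatrix}$$ (in the last two families $k$ ranges over $1\le k\le\frac{p-1}{2}$ and $0\le k\le\frac{p-1}{2}-1$ respectively); denote by $m_i$ the representative listed in the same position as the group $H_i$ (with $k$). For invertible $m=\begin{pmatrix}a&b\\c&d\end{pmatrix}$ the group with relations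 $[h_2,h_1]=h_3$, $[h_3,h_1]=h_4^ah_5^b$, $[h_3,h_2]=h_4^ch_5^d$, $h_1^p=h_4$, $h_2^p=h_5$ is isomorphic to $H_i$ if and only if $m$ lies in the orbit of $m_i$. -/

import Mathlib

universe u

/-- The commutator `[a, b] = a⁻¹ b⁻¹ a b`. -/
def rcomm {G : Type*} [Group G] (a b : G) : G := a⁻¹ * b⁻¹ * a * b

/-- The lower exponent-`p` central series: `γ₀ = G` and `γᵢ₊₁` is generated by all
`[h, g] * k ^ p` with `h, k ∈ γᵢ` and `g ∈ G`. -/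
def pCentralSeries (p : ℕ) (G : Type*) [Group G] : ℕ → Subgroup G
  | 0 => ⊤
  | i + 1 => Subgroup.closure
      {x | ∃ h ∈ pCentralSeries p G i, ∃ k ∈ pCentralSeries p G i, ∃ g : G,
        x = rcomm h g * k ^ p}

instance pCentralSeries_normal (p : ℕ) (G : Type*) [Group G] (i : ℕ) :
    (pCentralSeries p G i).Normal := by
  induction i with
  | zero => exact (inferInstance : (⊤ : Subgroup G).Normal)
  | succ i ih =>
    refine ⟨fun n hn g => ?_⟩
    rw [pCentralSeries] at hn ⊢
    induction hn using Subgroup.closure_induction with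
    | mem x hx =>
      obtain ⟨h, hh, k, hk, y, rfl⟩ := hx
      refine Subgroup.subset_closure
        ⟨g * h * g⁻¹, ih.conj_mem h hh g, g * k * g⁻¹, ih.conj_mem k hk g, g * y * g⁻¹, ?_⟩
      rw [conj_pow]
      simp only [rcomm]
      group
    | one => simp
    | mul x y _ _ hx hy => simpa [mul_assoc] using mul_mem hx hy
    | inv x _ hx => simpa [mul_assoc] using inv_mem hx

/-- `G` has `p`-class `c`: `c` is the least number with `γ_c(G) = 1`. -/
def HasPClass (p : ℕ) (G : Type*) [Group G] (c : ℕ) : Prop :=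
  IsLeast {i | pCentralSeries p G i = ⊥} c

/-- `H` is an immediate descendant of the finite `p`-group `G`: both are finite `p`-groups with the
same minimal number of generators, `G` has some `p`-class `c`, `H ⧸ γ_c(H) ≅ G`, and `H` has
`p`-class `c + 1`. -/
structure IsImmediateDescendant (p : ℕ) (G H : Type*) [Group G] [Group H] : Prop where
  [finite_left : Finite G]
  [finite_right : Finite H]
  isPGroup_left : IsPGroup p G
  isPGroup_right : IsPGroup p H
  rank_eq : Group.rank H = Group.rank G
  exists_class : ∃ c : ℕ, HasPClass p G c ∧ HasPClass p H (c + 1) ∧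
    Nonempty ((H ⧸ pCentralSeries p H c) ≃* G)

/-- The relators of a power-commutator presentation on `x₀, …, xₙ₋₁` with power relations
`xᵢ ^ p = pow i` and commutator relations `[xⱼ, xᵢ] = comm j i` for all `i < j`
(also those with right-hand side `1`). -/
def pcRelators (p : ℕ) {n : ℕ} (pow : Fin n → FreeGroup (Fin n))
    (comm : Fin n → Fin n → FreeGroup (Fin n)) : Set (FreeGroup (Fin n)) :=
  {r | ∃ i, r = FreeGroup.of i ^ p * (pow i)⁻¹} ∪
  {r | ∃ i j, i < j ∧ r = rcomm (FreeGroup.of j) (FreeGroup.of i) * (comm j i)⁻¹}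

/-- `D_p = ⟨a₁, a₂, a₃ ∣ [a₂, a₁] = a₃⟩`, trivial relations omitted in the notation. -/
abbrev GroupD (p : ℕ) : Type :=
  PresentedGroup (pcRelators p ![1, 1, 1]
    ![![1, 1, 1],
      ![FreeGroup.of (2 : Fin 3), 1, 1],
      ![1, 1, 1]])

/-- The generator `h₄` (the generators `h₁, …, h₅` are indexed by `0, …, 4`). -/
abbrev genFour : FreeGroup (Fin 5) := FreeGroup.of 3

/-- The generator `h₅`. -/
abbrev genFive : FreeGroup (Fin 5) := FreeGroup.of 4

/-- The group `⟨h₁, …, h₅ ∣ [h₂, h₁] = h₃, [h₃, h₁] = c₁, [h₃, h₂] = c₂, h₁ ^ p = q₁, h₂ ^ p = q₂⟩`,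
all other commutators of generators and `p`-th powers of generators being trivial. -/
abbrev GroupOrderFive (p : ℕ) (c₁ c₂ q₁ q₂ : FreeGroup (Fin 5)) : Type :=
  PresentedGroup (pcRelators p ![q₁, q₂, 1, 1, 1]
    ![![1, 1, 1, 1, 1],
      ![FreeGroup.of (2 : Fin 5), 1, 1, 1, 1],
      ![c₁, c₂, 1, 1, 1],
      ![1, 1, 1, 1, 1],
      ![1, 1, 1, 1, 1]])

/-- Powers with an exponent in `ℤ/p`, through the representative in `{0, …, p - 1}`. -/
def zmodPow {p : ℕ} {G : Type*} [Group G] (x : G) (a : ZMod p) : G := x ^ a.val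

/-- Labels of the list: `H₁, …, H₈`, `H₉ᵏ` with `1 ≤ k ≤ (p - 1) / 2`, and `H₁₀ᵏ` with
`0 ≤ k ≤ (p - 1) / 2 - 1`. -/
inductive DescLabel (p : ℕ) : Type
  | H1 | H2 | H3 | H4 | H5 | H6 | H7 | H8
  | H9 (k : ℕ) (hk : 1 ≤ k ∧ k ≤ (p - 1) / 2)
  | H10 (k : ℕ) (hk : k < (p - 1) / 2)

/-- The right-hand sides `([h₃, h₁], [h₃, h₂], h₁ ^ p, h₂ ^ p)` for each label. -/
def descData {p : ℕ} (w : (ZMod p)ˣ) : DescLabel p →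
    FreeGroup (Fin 5) × FreeGroup (Fin 5) × FreeGroup (Fin 5) × FreeGroup (Fin 5)
  | .H1 => (genFour, genFive, 1, 1)
  | .H2 => (genFour, genFive, 1, genFive)
  | .H3 => (genFour, genFive, 1, genFour)
  | .H4 => (genFour, genFive, 1, zmodPow genFour (w : ZMod p))
  | .H5 => (genFour, genFive, genFour, genFive)
  | .H6 => (genFour * genFive, genFive, genFour, genFive)
  | .H7 => (genFour * zmodPow genFive (w : ZMod p), genFive, genFour, genFive)
  | .H8 => (zmodPow genFive (w : ZMod p), genFour, genFour, genFive)
  | .H9 k _ => (genFour, zmodPow genFive ((w : ZMod p) ^ k), genFour, genFive)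
  | .H10 k _ => (genFour * zmodPow genFive ((w : ZMod p) ^ (k + 1)),
      zmodPow genFour ((w : ZMod p) ^ k) * genFive, genFour, genFive)

/-- The groups of the list. -/
abbrev DescGroup {p : ℕ} (w : (ZMod p)ˣ) (i : DescLabel p) : Type :=
  GroupOrderFive p (descData w i).1 (descData w i).2.1 (descData w i).2.2.1 (descData w i).2.2.2

/-- Groups (in a fixed universe) that are immediate descendants of `G` of order `n`. -/
def ImmDesc.{v} (p : ℕ) (G : Type v) [Group G] (n : ℕ) : Type (u + 1) :=
  {H : GrpCat.{u} // IsImmediateDescendant p G H ∧ Nat.card H = n}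

/-- Isomorphism of groups as an equivalence relation on `ImmDesc p G n`. -/
def ImmDesc.isoSetoid.{v} (p : ℕ) (G : Type v) [Group G] (n : ℕ) :
    Setoid (ImmDesc.{u, v} p G n) where
  r H K := Nonempty (H.1 ≃* K.1)
  iseqv :=
    { refl := fun H => ⟨MulEquiv.refl H.1⟩
      symm := fun ⟨e⟩ => ⟨e.symm⟩
      trans := fun ⟨e⟩ ⟨f⟩ => ⟨e.trans f⟩ }

/-- The action `(g, m) ↦ det(g) g⁻¹ m g` of `GL(2, p)` on `2 × 2` matrices. -/
def detConj {p : ℕ} [Fact p.Prime] (g : GL (Fin 2) (ZMod p)) (m : Matrix (Fin 2) (Fin 2) (ZMod p)) :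
    Matrix (Fin 2) (Fin 2) (ZMod p) :=
  (g : Matrix (Fin 2) (Fin 2) (ZMod p)).det •
    (((g⁻¹ : GL (Fin 2) (ZMod p)) : Matrix (Fin 2) (Fin 2) (ZMod p)) * m *
      (g : Matrix (Fin 2) (Fin 2) (ZMod p)))

/-- The list of orbit representatives for the action `detConj`, with the same labels. -/
def orbitRep {p : ℕ} (w : (ZMod p)ˣ) : DescLabel p → Matrix (Fin 2) (Fin 2) (ZMod p)
  | .H1 => !![0, 0; 0, 0]
  | .H2 => !![0, 0; 0, 1]
  | .H3 => !![0, 1; 0, 0]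
  | .H4 => !![0, (w : ZMod p); 0, 0]
  | .H5 => !![1, 0; 0, 1]
  | .H6 => !![1, 1; 0, 1]
  | .H7 => !![1, (w : ZMod p); 0, 1]
  | .H8 => !![0, (w : ZMod p); 1, 0]
  | .H9 k _ => !![1, 0; 0, (w : ZMod p) ^ k]
  | .H10 k _ => !![1, (w : ZMod p) ^ (k + 1); (w : ZMod p) ^ k, 1]

/-- For `m = (a, b; c, d)`, the group with `[h₂, h₁] = h₃`, `[h₃, h₁] = h₄ᵃ h₅ᵇ`,
`[h₃, h₂] = h₄ᶜ h₅ᵈ`, `h₁ ^ p = h₄`, `h₂ ^ p = h₅`. -/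
abbrev MatrixGroup {p : ℕ} (m : Matrix (Fin 2) (Fin 2) (ZMod p)) : Type :=
  GroupOrderFive p
    (zmodPow genFour (m 0 0) * zmodPow genFive (m 0 1))
    (zmodPow genFour (m 1 0) * zmodPow genFive (m 1 1))
    genFour genFive

/-! Let H be a descendant of order p^5 with generators h₁, h₂, and let V be the plane they span
modulo γ₁(H). The bottom layer Z = γ₂(H) is central of exponent p. The commutator h₃ = [h₂, h₁] has
order p, so Z is generated by [h₃, h₁] and [h₃, h₂]; by order they form a basis, and commutation
identifies Z with V ⊗ Λ²V. The p-th power map is a second linear map V → Z. Compared with the first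
it becomes a 2 × 2 matrix Q, and a change of generators by A replaces Q by det(A) A⁻¹QA, the
determinant coming from Λ²V. Hence isomorphism classes correspond to orbits of the action.

Every Q occurs, by the explicit model `Desc Q`: the Baker-Campbell-Hausdorff product of class three,
which needs 1/2 and 1/12 and hence p > 3, twisted by carry cocycles that produce the p-th powers
prescribed by Q. No consistency check of a presentation is needed: each presented group has order at
most p^5 and maps onto some `Desc Q` (`OrderFiveRelations.nonempty_mulEquiv`).
`Desc.nonempty_mulEquiv_iff` matches isomorphism with the orbit relation, and `exists_desc_mulEquiv`
shows that every descendant is some `Desc Q`.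

For the orbits, the form q(v) = v ∧ mv takes the same values on a whole orbit, because the
determinant twist cancels the factor of the change of basis. If q(v) = r ≠ 0, the basis v, mv puts m
in companion form, so an orbit is determined by one nonzero value of q together with (tr, det) up to
(c tr, c² det) (`detEquiv_of_wedgeForm`). If the discriminant is nonzero, q represents everything
and only trace and determinant matter. If it is zero and m is not scalar, q is a multiple of the
square of a linear form, and the square class of the multiple separates the representatives with 1
from those with w.

The list writes Q as the inverse of an invertible representative and as the transpose of a singular
one; `matDual` is this involution, and it respects orbits. -/

/-! ### The twisted conjugation action and its invariants -/

section Orbits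

variable {p : ℕ} [Fact p.Prime]

/-- Two matrices lie in the same orbit of `detConj`. -/
def DetEquiv (m m' : Matrix (Fin 2) (Fin 2) (ZMod p)) : Prop :=
  ∃ g : GL (Fin 2) (ZMod p), m' = detConj g m

theorem eq_detConj_iff (g : GL (Fin 2) (ZMod p)) (m m' : Matrix (Fin 2) (Fin 2) (ZMod p)) :
    m' = detConj g m ↔ (g : Matrix (Fin 2) (Fin 2) (ZMod p)) * m' =
      (g : Matrix (Fin 2) (Fin 2) (ZMod p)).det • (m * (g : Matrix (Fin 2) (Fin 2) (ZMod p))) := by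
  constructor
  · rintro rfl
    rw [detConj, Matrix.mul_smul, mul_assoc, ← mul_assoc (g : Matrix (Fin 2) (Fin 2) (ZMod p)),
      Units.mul_inv, one_mul]
  · intro h
    rw [detConj, mul_assoc, ← Matrix.mul_smul, ← h, ← mul_assoc, Units.inv_mul, one_mul]

theorem detEquiv_iff {m m' : Matrix (Fin 2) (Fin 2) (ZMod p)} :
    DetEquiv m m' ↔ ∃ A : Matrix (Fin 2) (Fin 2) (ZMod p), A.det ≠ 0 ∧ A * m' = A.det • (m * A) := by
  constructor
  · rintro ⟨g, hg⟩
    exact ⟨g, (g.isUnit.map Matrix.detMonoidHom).ne_zero, (eq_detConj_iff g m m').1 hg⟩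
  · rintro ⟨A, hA, h⟩
    exact ⟨Matrix.GeneralLinearGroup.mkOfDetNeZero A hA, (eq_detConj_iff _ _ _).2 h⟩

theorem DetEquiv.refl (m : Matrix (Fin 2) (Fin 2) (ZMod p)) : DetEquiv m m :=
  detEquiv_iff.2 ⟨1, by simp, by simp⟩

theorem DetEquiv.trans {m₁ m₂ m₃ : Matrix (Fin 2) (Fin 2) (ZMod p)} (h : DetEquiv m₁ m₂)
    (h' : DetEquiv m₂ m₃) : DetEquiv m₁ m₃ := by
  obtain ⟨A, hA, h⟩ := detEquiv_iff.1 h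
  obtain ⟨B, hB, h'⟩ := detEquiv_iff.1 h'
  refine detEquiv_iff.2 ⟨A * B, by simp [hA, hB], ?_⟩
  rw [mul_assoc, h', Matrix.mul_smul, ← mul_assoc, h, Matrix.det_mul, Matrix.smul_mul, smul_smul,
    mul_comm B.det, mul_assoc]

theorem DetEquiv.symm {m₁ m₂ : Matrix (Fin 2) (Fin 2) (ZMod p)} (h : DetEquiv m₁ m₂) :
    DetEquiv m₂ m₁ := by
  obtain ⟨A, hA, h⟩ := detEquiv_iff.1 h
  have hu : IsUnit A.det := hA.isUnit
  refine detEquiv_iff.2 ⟨A⁻¹, by simp [Matrix.det_nonsing_inv, hA], ?_⟩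
  have : m₁ * A = A.det⁻¹ • (A * m₂) := by rw [h, smul_smul, inv_mul_cancel₀ hA, one_smul]
  have h2 : m₁ = A.det⁻¹ • (A * m₂ * A⁻¹) := by
    rw [← Matrix.smul_mul, ← this, Matrix.mul_nonsing_inv_cancel_right _ _ hu]
  rw [Matrix.det_nonsing_inv, Ring.inverse_eq_inv', h2, Matrix.mul_smul, mul_assoc,
    Matrix.nonsing_inv_mul_cancel_left _ _ hu]

/-- Scalar matrices act by squares, so the sign of the exponent of `det g` is irrelevant. -/
theorem detEquiv_of_mul_eq {m m' A : Matrix (Fin 2) (Fin 2) (ZMod p)} {c : ZMod p}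
    (hA : A.det ≠ 0) (hc : c ≠ 0) (h : A * m' = (c ^ 2 * A.det) • (m * A)) : DetEquiv m m' := by
  refine detEquiv_iff.2 ⟨c • A, by simp [hA, hc], ?_⟩
  rw [Matrix.smul_mul, h, Matrix.det_smul, Matrix.mul_smul, smul_smul, smul_smul]
  simp only [Fintype.card_fin]
  ring_nf

/-- Inverting the relation turns the factor `det A` into its inverse; the scalar `c = (det A)⁻¹`
repairs this, since c² det A = (det A)⁻¹. Transposition is repaired in the same way. -/
theorem DetEquiv.inv {m m' : Matrix (Fin 2) (Fin 2) (ZMod p)} (h : DetEquiv m m')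
    (hm : m.det ≠ 0) : DetEquiv m⁻¹ m'⁻¹ := by
  obtain ⟨A, hA, h⟩ := detEquiv_iff.1 h
  have hm' : m'.det ≠ 0 := by
    intro h0
    have := congrArg Matrix.det h
    rw [Matrix.det_mul, h0, Matrix.det_smul, Matrix.det_mul] at this
    simp [hA, hm] at this
  refine detEquiv_of_mul_eq (A := A) (c := A.det⁻¹) hA (inv_ne_zero hA) ?_
  have h1 : m⁻¹ * (A * m') * m'⁻¹ = A.det • (m⁻¹ * (m * A) * m'⁻¹) := by
    rw [h, Matrix.mul_smul, Matrix.smul_mul]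
  rw [← mul_assoc, Matrix.mul_nonsing_inv_cancel_right _ _ hm'.isUnit,
    Matrix.nonsing_inv_mul_cancel_left _ _ hm.isUnit] at h1
  rw [h1, smul_smul]
  have : A.det⁻¹ ^ 2 * A.det * A.det = 1 := by field_simp
  rw [this, one_smul]

theorem DetEquiv.transpose {m m' : Matrix (Fin 2) (Fin 2) (ZMod p)} (h : DetEquiv m m') :
    DetEquiv m.transpose m'.transpose := by
  obtain ⟨A, hA, h⟩ := detEquiv_iff.1 h
  refine DetEquiv.symm (detEquiv_of_mul_eq (A := A.transpose) (c := A.det⁻¹) (by simpa using hA)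
    (inv_ne_zero hA) ?_)
  have h1 := congrArg Matrix.transpose h
  rw [Matrix.transpose_mul, Matrix.transpose_smul, Matrix.transpose_mul] at h1
  rw [h1, smul_smul, Matrix.det_transpose]
  have : A.det⁻¹ ^ 2 * A.det * A.det = 1 := by field_simp
  rw [this, one_smul]

/-- The inverse of an invertible matrix, and the transpose of a singular one. -/
noncomputable def matDual (m : Matrix (Fin 2) (Fin 2) (ZMod p)) : Matrix (Fin 2) (Fin 2) (ZMod p) :=
  open Classical in if m.det = 0 then m.transpose else m⁻¹

theorem matDual_of_det_ne_zero {m : Matrix (Fin 2) (Fin 2) (ZMod p)} (h : m.det ≠ 0) :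
    matDual m = m⁻¹ := if_neg h

theorem matDual_of_det_eq_zero {m : Matrix (Fin 2) (Fin 2) (ZMod p)} (h : m.det = 0) :
    matDual m = m.transpose := if_pos h

theorem matDual_matDual (m : Matrix (Fin 2) (Fin 2) (ZMod p)) : matDual (matDual m) = m := by
  by_cases h : m.det = 0
  · rw [matDual_of_det_eq_zero h, matDual_of_det_eq_zero (by simpa using h),
      Matrix.transpose_transpose]
  · rw [matDual_of_det_ne_zero h, matDual_of_det_ne_zero (by simp [Matrix.det_nonsing_inv, h]),
      Matrix.nonsing_inv_nonsing_inv _ (Ne.isUnit h)]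

theorem DetEquiv.trace_det {m m' : Matrix (Fin 2) (Fin 2) (ZMod p)} (h : DetEquiv m m') :
    ∃ c : ZMod p, c ≠ 0 ∧ m'.trace = c * m.trace ∧ m'.det = c ^ 2 * m.det := by
  obtain ⟨g, rfl⟩ := h
  have hg : (g : Matrix (Fin 2) (Fin 2) (ZMod p)).det ≠ 0 :=
    (g.isUnit.map Matrix.detMonoidHom).ne_zero
  refine ⟨_, hg, ?_, ?_⟩
  · rw [detConj, Matrix.trace_smul, mul_assoc, Matrix.trace_mul_comm, mul_assoc, Units.mul_inv,
      mul_one, smul_eq_mul]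
  · have h1 : ((g⁻¹ : GL (Fin 2) (ZMod p)) : Matrix (Fin 2) (Fin 2) (ZMod p)).det *
        (g : Matrix (Fin 2) (Fin 2) (ZMod p)).det = 1 := by
      rw [← Matrix.det_mul, Units.inv_mul, Matrix.det_one]
    rw [detConj, Matrix.det_smul, Matrix.det_mul, Matrix.det_mul, Fintype.card_fin]
    linear_combination (g : Matrix (Fin 2) (Fin 2) (ZMod p)).det ^ 2 * m.det * h1

theorem DetEquiv.matDual {m m' : Matrix (Fin 2) (Fin 2) (ZMod p)} (h : DetEquiv m m') :
    DetEquiv (matDual m) (matDual m') := by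
  obtain ⟨c, hc, -, h2⟩ := h.trace_det
  by_cases hm : m.det = 0
  · rw [matDual_of_det_eq_zero hm, matDual_of_det_eq_zero (by simp [h2, hm])]
    exact h.transpose
  · rw [matDual_of_det_ne_zero hm, matDual_of_det_ne_zero (by simp [h2, hm, hc])]
    exact h.inv hm

/-- The value at `(x, y)` of the quadratic form `v ↦ v ∧ m v`. -/
def wedgeForm (m : Matrix (Fin 2) (Fin 2) (ZMod p)) (x y : ZMod p) : ZMod p :=
  m 1 0 * x ^ 2 + (m 1 1 - m 0 0) * x * y - m 0 1 * y ^ 2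

/-- The value of the form of m' at v is the value of the form of m at Av: the twist by det A cancels
the factor det(A)⁻¹ by which A⁻¹ scales the wedge. The values are thus preserved exactly, not merely
up to squares. -/
theorem DetEquiv.exists_wedgeForm {m m' : Matrix (Fin 2) (Fin 2) (ZMod p)} (h : DetEquiv m m')
    {r : ZMod p} (hr : ∃ x y, wedgeForm m' x y = r) : ∃ x y, wedgeForm m x y = r := by
  obtain ⟨A, hA, h⟩ := detEquiv_iff.1 h
  obtain ⟨x, y, rfl⟩ := hr
  refine ⟨A 0 0 * x + A 0 1 * y, A 1 0 * x + A 1 1 * y, ?_⟩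
  have e00 := congrFun (congrFun h 0) 0
  have e01 := congrFun (congrFun h 0) 1
  have e10 := congrFun (congrFun h 1) 0
  have e11 := congrFun (congrFun h 1) 1
  simp only [Matrix.mul_apply, Fin.sum_univ_two, Matrix.smul_apply, smul_eq_mul,
    Matrix.det_fin_two] at e00 e01 e10 e11 hA
  -- After multiplication by det A both sides equal Av ∧ Am'v.
  apply mul_left_cancel₀ hA
  simp only [wedgeForm]
  linear_combination (A 1 0 * x ^ 2 + A 1 1 * x * y) * e00 + (A 1 0 * x * y + A 1 1 * y ^ 2) * e01
    - (A 0 0 * x ^ 2 + A 0 1 * x * y) * e10 - (A 0 0 * x * y + A 0 1 * y ^ 2) * e11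

/-- Cayley-Hamilton in the basis v, s·mv with v = (x, y). This basis has determinant s·r, which is
the twisting factor. -/
theorem detEquiv_companion (m : Matrix (Fin 2) (Fin 2) (ZMod p)) {x y r s : ZMod p}
    (hr : wedgeForm m x y = r) (hr0 : r ≠ 0) (hs : s ≠ 0) :
    DetEquiv m !![0, -s ^ 2 * r * m.det; r, s * r * m.trace] := by
  have hdet : (!![x, s * (m 0 0 * x + m 0 1 * y); y, s * (m 1 0 * x + m 1 1 * y)] :
      Matrix (Fin 2) (Fin 2) (ZMod p)).det = s * r := by
    rw [Matrix.det_fin_two_of, ← hr, wedgeForm]; ring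
  refine detEquiv_iff.2 ⟨_, by rw [hdet]; exact mul_ne_zero hs hr0, ?_⟩
  rw [hdet]
  ext i j
  fin_cases i <;> fin_cases j <;>
    simp [Matrix.mul_apply, Fin.sum_univ_two, Matrix.det_fin_two, Matrix.trace_fin_two] <;> ring

/-- Both matrices reach the same companion form, m with s = c and m' with s = 1. This is the sole
criterion used for orbits of non-scalar matrices. -/
theorem detEquiv_of_wedgeForm {m m' : Matrix (Fin 2) (Fin 2) (ZMod p)} {r c : ZMod p}
    (hr0 : r ≠ 0) (hc : c ≠ 0) (hr : ∃ x y, wedgeForm m x y = r)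
    (hr' : ∃ x y, wedgeForm m' x y = r) (ht : m'.trace = c * m.trace)
    (hd : m'.det = c ^ 2 * m.det) : DetEquiv m m' := by
  obtain ⟨x, y, hr⟩ := hr
  obtain ⟨x', y', hr'⟩ := hr'
  have h1 := detEquiv_companion m hr hr0 hc
  have h2 := detEquiv_companion m' hr' hr0 one_ne_zero
  rw [ht, hd] at h2
  have : (!![0, -1 ^ 2 * r * (c ^ 2 * m.det); r, 1 * r * (c * m.trace)] :
      Matrix (Fin 2) (Fin 2) (ZMod p)) = !![0, -c ^ 2 * r * m.det; r, c * r * m.trace] := by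
    congr 2 <;> ring_nf
  rw [this] at h2
  exact h1.trans h2.symm

/-- The discriminant of the characteristic polynomial. -/
def matDisc (m : Matrix (Fin 2) (Fin 2) (ZMod p)) : ZMod p := m.trace ^ 2 - 4 * m.det

theorem DetEquiv.isSquare_matDisc {m m' : Matrix (Fin 2) (Fin 2) (ZMod p)} (h : DetEquiv m m') :
    IsSquare (matDisc m') ↔ IsSquare (matDisc m) := by
  obtain ⟨c, hc, h1, h2⟩ := h.trace_det
  have : matDisc m' = c ^ 2 * matDisc m := by rw [matDisc, matDisc, h1, h2]; ring
  rw [this]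
  constructor
  · rintro ⟨r, hr⟩
    exact ⟨r / c, by field_simp; linear_combination hr⟩
  · rintro ⟨r, hr⟩
    exact ⟨c * r, by rw [hr]; ring⟩

theorem exists_sq_sub_mul_sq {a b : ZMod p} (hp : p ≠ 2) (ha : a ≠ 0) : ∃ x y, x ^ 2 - a * y ^ 2 = b := by
  open Polynomial in
  obtain ⟨x, y, h⟩ := FiniteField.exists_root_sum_quadratic (R := ZMod p)
    (f := X ^ 2) (g := C (-a) * X ^ 2 + C 0 * X + C (-b)) (degree_X_pow 2)
    (degree_quadratic (neg_ne_zero.2 ha)) (by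
      rw [ZMod.card]; exact (Nat.Prime.eq_two_or_odd (Fact.out : p.Prime)).resolve_left hp)
  refine ⟨x, y, ?_⟩
  simp at h
  linear_combination h

theorem two_ne_zero_of_ne_two (hp : p ≠ 2) : (2 : ZMod p) ≠ 0 := by
  intro h
  have : ((2 : ℕ) : ZMod p) = 0 := by exact_mod_cast h
  rw [ZMod.natCast_eq_zero_iff] at this
  exact hp ((Nat.prime_dvd_prime_iff_eq Fact.out Nat.prime_two).1 this)

/-- The discriminant of m is also that of the binary form, and a nondegenerate binary form over a
finite field of odd characteristic is universal. -/
theorem exists_wedgeForm_eq {m : Matrix (Fin 2) (Fin 2) (ZMod p)} (hp : p ≠ 2)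
    (hm : matDisc m ≠ 0) (r : ZMod p) : ∃ x y, wedgeForm m x y = r := by
  have h2 := two_ne_zero_of_ne_two hp
  rw [matDisc, Matrix.trace_fin_two, Matrix.det_fin_two] at hm
  by_cases hc : m 1 0 = 0
  · have hd : m 1 1 - m 0 0 ≠ 0 := by
      intro h; apply hm; rw [hc]; linear_combination (m 1 1 - m 0 0) * h
    exact ⟨(r + m 0 1) / (m 1 1 - m 0 0), 1, by rw [wedgeForm, hc]; field_simp; ring⟩
  -- Completing the square: 4 m₁₀ q(X, y) = (2 m₁₀ X + (m₁₁ - m₀₀) y)² - disc · y².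
  · obtain ⟨x, y, h⟩ := exists_sq_sub_mul_sq (b := 4 * m 1 0 * r) hp hm
    refine ⟨(x - (m 1 1 - m 0 0) * y) / (2 * m 1 0), y, ?_⟩
    rw [wedgeForm]
    field_simp
    linear_combination h

end Orbits

/-! ### The listed matrices lie in distinct orbits -/

section Representatives

variable {p : ℕ} [Fact p.Prime]

theorem orderOf_of_forall_mem_zpowers {w : (ZMod p)ˣ} (hw : ∀ x, x ∈ Subgroup.zpowers w) :
    orderOf w = p - 1 := by
  rw [orderOf_eq_card_of_forall_mem_zpowers hw, Nat.card_eq_fintype_card, ZMod.card_units]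

theorem exists_pow_eq {w : (ZMod p)ˣ} (hw : ∀ x, x ∈ Subgroup.zpowers w) {x : ZMod p}
    (hx : x ≠ 0) : ∃ k < p - 1, x = (w : ZMod p) ^ k := by
  have h := hw (Units.mk0 x hx)
  rw [← mem_powers_iff_mem_zpowers, mem_powers_iff_mem_range_orderOf] at h
  obtain ⟨k, hk, h⟩ := Finset.mem_image.1 h
  refine ⟨k, by rwa [Finset.mem_range, orderOf_of_forall_mem_zpowers hw] at hk, ?_⟩
  have := congrArg Units.val h
  simpa using this.symm

theorem pow_eq_one_iff_dvd {w : (ZMod p)ˣ} (hw : ∀ x, x ∈ Subgroup.zpowers w) (k : ℕ) :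
    (w : ZMod p) ^ k = 1 ↔ p - 1 ∣ k := by
  rw [← orderOf_of_forall_mem_zpowers hw, orderOf_dvd_iff_pow_eq_one, Units.ext_iff]
  simp

theorem pow_injOn {w : (ZMod p)ˣ} (hw : ∀ x, x ∈ Subgroup.zpowers w) {k l : ℕ} (hk : k < p - 1)
    (hl : l < p - 1) (h : (w : ZMod p) ^ k = (w : ZMod p) ^ l) : k = l := by
  rw [← orderOf_of_forall_mem_zpowers hw] at hk hl
  refine pow_injOn_Iio_orderOf hk hl (Units.ext (by simpa using h))

theorem not_isSquare_pow_odd {w : (ZMod p)ˣ} (hw : ∀ x, x ∈ Subgroup.zpowers w) (hp : p ≠ 2)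
    (k : ℕ) : ¬ IsSquare ((w : ZMod p) ^ (2 * k + 1)) := by
  rintro ⟨r, hr⟩
  have hr0 : r ≠ 0 := by
    rintro rfl
    exact pow_ne_zero (2 * k + 1) w.ne_zero (by rw [hr, mul_zero])
  obtain ⟨l, -, rfl⟩ := exists_pow_eq hw hr0
  have hodd := (Nat.Prime.eq_two_or_odd' (Fact.out : p.Prime)).resolve_left hp
  obtain ⟨q, hq⟩ := hodd
  rw [← pow_add, ← Units.val_pow_eq_pow_val, ← Units.val_pow_eq_pow_val, ← Units.ext_iff,
    pow_eq_pow_iff_modEq, orderOf_of_forall_mem_zpowers hw] at hr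
  have h2 : 2 ∣ p - 1 := ⟨q, by omega⟩
  have := hr.of_dvd h2
  rw [Nat.ModEq] at this
  omega

theorem not_isSquare_generator {w : (ZMod p)ˣ} (hw : ∀ x, x ∈ Subgroup.zpowers w) (hp : p ≠ 2) :
    ¬ IsSquare (w : ZMod p) := by
  simpa using not_isSquare_pow_odd hw hp 0

/-- A number distinguishing the types of orbits. -/
noncomputable def orbitTag (w : (ZMod p)ˣ) (m : Matrix (Fin 2) (Fin 2) (ZMod p)) : ℕ :=
  open Classical in
  if matDisc m = 0 then
    if m.trace = 0 then
      if ∃ x y, wedgeForm m x y = -1 then 3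
      else if ∃ x y, wedgeForm m x y = -w then 4 else 1
    else
      if ∃ x y, wedgeForm m x y = -1 then 6
      else if ∃ x y, wedgeForm m x y = -w then 7 else 5
  else if IsSquare (matDisc m) then
    if m.det = 0 then 2 else 9
  else
    if m.trace = 0 then 8 else 10

/-- Each test in the tag is invariant: trace, determinant and discriminant are multiplied by c, c²
and c² with c ≠ 0, and the form keeps its set of values. -/
theorem DetEquiv.orbitTag_eq {m m' : Matrix (Fin 2) (Fin 2) (ZMod p)} (h : DetEquiv m m')
    (w : (ZMod p)ˣ) : orbitTag w m = orbitTag w m' := by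
  obtain ⟨c, hc, h1, h2⟩ := h.trace_det
  have e1 : matDisc m' = 0 ↔ matDisc m = 0 := by
    have : matDisc m' = c ^ 2 * matDisc m := by rw [matDisc, matDisc, h1, h2]; ring
    simp [this, hc]
  have e2 : m'.trace = 0 ↔ m.trace = 0 := by simp [h1, hc]
  have e3 : m'.det = 0 ↔ m.det = 0 := by simp [h2, hc]
  have e4 (r : ZMod p) : (∃ x y, wedgeForm m' x y = r) ↔ ∃ x y, wedgeForm m x y = r :=
    ⟨h.exists_wedgeForm, h.symm.exists_wedgeForm⟩
  simp only [orbitTag, e1, e2, e3, e4, h.isSquare_matDisc]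

/-- The number of a label, without its parameter. -/
def DescLabel.tag : DescLabel p → ℕ
  | .H1 => 1
  | .H2 => 2
  | .H3 => 3
  | .H4 => 4
  | .H5 => 5
  | .H6 => 6
  | .H7 => 7
  | .H8 => 8
  | .H9 _ _ => 9
  | .H10 _ _ => 10

theorem trace_orbitRep_H10 (w : (ZMod p)ˣ) (k hk) : (orbitRep w (.H10 k hk)).trace = 2 := by
  simp [orbitRep, Matrix.trace_fin_two, one_add_one_eq_two]

theorem det_orbitRep_H10 (w : (ZMod p)ˣ) (k hk) :
    (orbitRep w (.H10 k hk)).det = 1 - (w : ZMod p) ^ (2 * k + 1) := by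
  simp [orbitRep, Matrix.det_fin_two]
  ring

theorem one_sub_pow_ne_zero {w : (ZMod p)ˣ} (hw : ∀ x, x ∈ Subgroup.zpowers w)
    {k : ℕ} (hk : 1 ≤ k ∧ k ≤ (p - 1) / 2) : 1 - (w : ZMod p) ^ k ≠ 0 := by
  intro h
  have h1 : p - 1 ∣ k := (pow_eq_one_iff_dvd hw k).1 (by linear_combination -h)
  have := Nat.le_of_dvd (by omega) h1
  omega

theorem four_ne_zero_of_ne_two (hp : p ≠ 2) : (4 : ZMod p) ≠ 0 := by
  have h2 := two_ne_zero_of_ne_two hp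
  have : (4 : ZMod p) = 2 * 2 := by norm_num
  rw [this]
  exact mul_ne_zero h2 h2

theorem isSquare_four_mul {a : ZMod p} (hp : p ≠ 2) : IsSquare (4 * a) ↔ IsSquare a := by
  have h2 := two_ne_zero_of_ne_two hp
  constructor
  · rintro ⟨r, hr⟩
    exact ⟨r / 2, by field_simp; linear_combination hr⟩
  · rintro ⟨r, hr⟩
    exact ⟨2 * r, by rw [hr]; ring⟩

theorem orbitTag_orbitRep {w : (ZMod p)ˣ} (hw : ∀ x, x ∈ Subgroup.zpowers w) (hp : 3 < p)
    (i : DescLabel p) : orbitTag w (orbitRep w i) = i.tag := by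
  have hp2 : p ≠ 2 := by omega
  have h2 := two_ne_zero_of_ne_two hp2
  have h4 := four_ne_zero_of_ne_two hp2
  have hw2 := not_isSquare_generator hw hp2
  -- The forms of H₄ and H₇ are -w y², so they miss -1 because w is not a square.
  have hnrep (y : ZMod p) : ¬ (w : ZMod p) * y ^ 2 = 1 := by
    intro hy
    have hy0 : y ≠ 0 := by rintro rfl; simp at hy
    exact hw2 ⟨y⁻¹, by field_simp; exact hy⟩
  have h4' : (1 + 1 : ZMod p) ^ 2 - 4 = 0 := by ring
  have h2' : (1 + 1 : ZMod p) ≠ 0 := by rwa [one_add_one_eq_two]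
  cases i with
  | H1 => simp [orbitTag, orbitRep, matDisc, Matrix.det_fin_two, Matrix.trace_fin_two, wedgeForm,
      DescLabel.tag]
  | H2 => simp [orbitTag, orbitRep, matDisc, Matrix.det_fin_two, Matrix.trace_fin_two,
      DescLabel.tag]
  | H3 =>
    simp [orbitTag, orbitRep, matDisc, Matrix.det_fin_two, Matrix.trace_fin_two, wedgeForm,
      DescLabel.tag]
  | H4 =>
    simp only [orbitTag, orbitRep, matDisc, Matrix.det_fin_two, Matrix.trace_fin_two, wedgeForm,
      DescLabel.tag]
    simp [hnrep]
  | H5 => simp [orbitTag, orbitRep, matDisc, Matrix.det_fin_two, Matrix.trace_fin_two, wedgeForm,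
      DescLabel.tag, h4', h2']
  | H6 =>
    simp [orbitTag, orbitRep, matDisc, Matrix.det_fin_two, Matrix.trace_fin_two, wedgeForm,
      DescLabel.tag, h4', h2']
  | H7 =>
    simp only [orbitTag, orbitRep, matDisc, Matrix.det_fin_two, Matrix.trace_fin_two, wedgeForm,
      DescLabel.tag]
    simp [hnrep, h4', h2']
  | H8 =>
    simp [orbitTag, orbitRep, matDisc, Matrix.det_fin_two, Matrix.trace_fin_two, DescLabel.tag,
      h4, isSquare_four_mul hp2, hw2]
  | H9 k hk =>
    have h := one_sub_pow_ne_zero hw hk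
    have hd : matDisc (orbitRep w (.H9 k hk)) = (1 - (w : ZMod p) ^ k) * (1 - (w : ZMod p) ^ k) := by
      simp [orbitRep, matDisc, Matrix.det_fin_two, Matrix.trace_fin_two]; ring
    rw [orbitTag, if_neg (by rw [hd]; exact mul_ne_zero h h), if_pos ⟨_, hd⟩,
      if_neg (by simp [orbitRep]), DescLabel.tag]
  | H10 k hk =>
    have hd : matDisc (orbitRep w (.H10 k hk)) = 4 * (w : ZMod p) ^ (2 * k + 1) := by
      rw [matDisc, trace_orbitRep_H10, det_orbitRep_H10]; ring
    have hs : ¬ IsSquare (matDisc (orbitRep w (.H10 k hk))) := by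
      rw [hd, isSquare_four_mul hp2]
      exact not_isSquare_pow_odd hw hp2 k
    rw [orbitTag, if_neg (by rintro h0; exact hs (h0 ▸ IsSquare.zero)), if_neg hs,
      trace_orbitRep_H10, if_neg h2, DescLabel.tag]

theorem eq_of_detEquiv_orbitRep {w : (ZMod p)ˣ} (hw : ∀ x, x ∈ Subgroup.zpowers w) (hp : 3 < p)
    {i j : DescLabel p} (h : DetEquiv (orbitRep w i) (orbitRep w j)) : i = j := by
  have ht := h.orbitTag_eq w
  rw [orbitTag_orbitRep hw hp, orbitTag_orbitRep hw hp] at ht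
  obtain ⟨c, hc, h1, h2⟩ := h.trace_det
  have h2' := two_ne_zero_of_ne_two (p := p) (by omega)
  cases i <;> cases j <;> simp only [DescLabel.tag, Nat.reduceEqDiff] at ht <;>
    try rfl
  case H9.H9 k hk l hl =>
    simp only [orbitRep, Matrix.trace_fin_two_of, Matrix.det_fin_two_of, one_mul, mul_zero,
      sub_zero] at h1 h2
    -- Eliminating c gives tr'² det = tr² det', which factors like this: the ratio of the
    -- eigenvalues is determined up to inversion.
    have key : ((w : ZMod p) ^ k - (w : ZMod p) ^ l) * (1 - (w : ZMod p) ^ (k + l)) = 0 := by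
      rw [pow_add]
      linear_combination ((w : ZMod p) ^ k * (1 + (w : ZMod p) ^ l + c * (1 + (w : ZMod p) ^ k))) * h1
        - (1 + (w : ZMod p) ^ k) ^ 2 * h2
    rcases mul_eq_zero.1 key with h | h
    · have := pow_injOn hw (by omega) (by omega) (sub_eq_zero.1 h)
      subst this; rfl
    -- Here p - 1 divides k + l ≤ p - 1, which forces k = l = (p - 1) / 2.
    · have h3 := (pow_eq_one_iff_dvd hw _).1 (sub_eq_zero.1 h).symm
      have := Nat.le_of_dvd (by omega) h3
      have : k = l := by omega
      subst this; rfl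
  case H10.H10 k hk l hl =>
    rw [trace_orbitRep_H10, trace_orbitRep_H10] at h1
    have hc1 : c = 1 := mul_right_cancel₀ h2' (by linear_combination -h1)
    rw [det_orbitRep_H10, det_orbitRep_H10, hc1] at h2
    have := pow_injOn hw (by omega) (by omega)
      (show (w : ZMod p) ^ (2 * k + 1) = (w : ZMod p) ^ (2 * l + 1) by linear_combination h2)
    have : k = l := by omega
    subst this; rfl

end Representatives

/-! ### Every matrix is equivalent to a listed one -/

section Completeness

/-- Labels without dependent bounds. -/
def descLabelEquiv {p : ℕ} : DescLabel p ≃ Fin 8 ⊕ Fin ((p - 1) / 2) ⊕ Fin ((p - 1) / 2) where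
  toFun
    | .H1 => .inl 0
    | .H2 => .inl 1
    | .H3 => .inl 2
    | .H4 => .inl 3
    | .H5 => .inl 4
    | .H6 => .inl 5
    | .H7 => .inl 6
    | .H8 => .inl 7
    | .H9 k hk => .inr (.inl ⟨k - 1, by omega⟩)
    | .H10 k hk => .inr (.inr ⟨k, hk⟩)
  invFun
    | .inl 0 => .H1
    | .inl 1 => .H2
    | .inl 2 => .H3
    | .inl 3 => .H4
    | .inl 4 => .H5
    | .inl 5 => .H6
    | .inl 6 => .H7
    | .inl 7 => .H8
    | .inr (.inl k) => .H9 (k + 1) ⟨by omega, by omega⟩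
    | .inr (.inr k) => .H10 k k.2
  left_inv i := by
    cases i <;> try rfl
    case H9 k hk => simp [Nat.sub_add_cancel hk.1]
  right_inv i := by
    rcases i with i | i | i
    · fin_cases i <;> rfl
    · simp
    · rfl

variable {p : ℕ} [Fact p.Prime]

theorem wedgeForm_smul (m : Matrix (Fin 2) (Fin 2) (ZMod p)) (c x y : ZMod p) :
    wedgeForm m (c * x) (c * y) = c ^ 2 * wedgeForm m x y := by
  simp only [wedgeForm]; ring

theorem exists_eq_sq_or_eq_mul_sq {w : (ZMod p)ˣ} (hw : ∀ x, x ∈ Subgroup.zpowers w) {r : ZMod p}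
    (hr : r ≠ 0) : ∃ s, s ≠ 0 ∧ (r = s ^ 2 ∨ r = w * s ^ 2) := by
  obtain ⟨k, -, rfl⟩ := exists_pow_eq hw hr
  obtain ⟨l, rfl | rfl⟩ := k.even_or_odd'
  · exact ⟨w ^ l, pow_ne_zero _ w.ne_zero, .inl (by ring)⟩
  · exact ⟨w ^ l, pow_ne_zero _ w.ne_zero, .inr (by ring)⟩

/-- If v ∧ mv vanishes identically, every vector is an eigenvector. -/
theorem eq_smul_one_or_exists_wedgeForm_ne_zero (m : Matrix (Fin 2) (Fin 2) (ZMod p)) :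
    (∃ a : ZMod p, m = a • 1) ∨ ∃ x y, wedgeForm m x y ≠ 0 := by
  by_contra! h
  obtain ⟨h1, h2⟩ := h
  have e1 := h2 1 0
  have e2 := h2 0 1
  have e3 := h2 1 1
  simp only [wedgeForm] at e1 e2 e3
  refine h1 (m 0 0) ?_
  ext i j
  fin_cases i <;> fin_cases j <;> simp
  · linear_combination -e2
  · linear_combination e1
  · linear_combination e3 - e1 - e2

theorem exists_wedgeForm_neg_one_or {w : (ZMod p)ˣ} (hw : ∀ x, x ∈ Subgroup.zpowers w)
    {m : Matrix (Fin 2) (Fin 2) (ZMod p)} (hm : ∃ x y, wedgeForm m x y ≠ 0) :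
    (∃ x y, wedgeForm m x y = -1) ∨ ∃ x y, wedgeForm m x y = -w := by
  obtain ⟨x, y, h⟩ := hm
  obtain ⟨s, hs, h1 | h1⟩ := exists_eq_sq_or_eq_mul_sq hw (neg_ne_zero.2 h)
  · refine .inl ⟨s⁻¹ * x, s⁻¹ * y, ?_⟩
    rw [wedgeForm_smul, ← neg_neg (wedgeForm m x y), h1]
    field_simp
  · refine .inr ⟨s⁻¹ * x, s⁻¹ * y, ?_⟩
    rw [wedgeForm_smul, ← neg_neg (wedgeForm m x y), h1]
    field_simp

/-- Conjugation fixes scalar matrices, so only the determinant acts, and it takes the value b / a.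
All nonzero scalars thus fall into the orbit of H₅. -/
theorem detEquiv_smul_one {a b : ZMod p} (ha : a ≠ 0) (hb : b ≠ 0) :
    DetEquiv (a • (1 : Matrix (Fin 2) (Fin 2) (ZMod p))) (b • 1) := by
  refine detEquiv_iff.2 ⟨!![b / a, 0; 0, 1], by simp [ha, hb], ?_⟩
  simp only [Matrix.det_fin_two_of, Matrix.smul_mul, Matrix.mul_smul, one_mul, mul_one, smul_smul]
  congr 1
  field_simp
  ring

theorem exists_orbitRep_of_disc_eq_zero {w : (ZMod p)ˣ} (hw : ∀ x, x ∈ Subgroup.zpowers w)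
    (hp : p ≠ 2) {m : Matrix (Fin 2) (Fin 2) (ZMod p)} (hd : matDisc m = 0) :
    ∃ i, DetEquiv (orbitRep w i) m := by
  have h2 := two_ne_zero_of_ne_two hp
  have h4 := four_ne_zero_of_ne_two hp
  obtain ⟨a, rfl⟩ | hq := eq_smul_one_or_exists_wedgeForm_ne_zero m
  · by_cases ha : a = 0
    · refine ⟨.H1, ?_⟩
      have : orbitRep w .H1 = a • 1 := by
        rw [ha, zero_smul]; ext i j; fin_cases i <;> fin_cases j <;> rfl
      rw [this]; exact DetEquiv.refl _
    · refine ⟨.H5, ?_⟩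
      have : orbitRep w .H5 = (1 : ZMod p) • 1 := by
        rw [one_smul]; ext i j; fin_cases i <;> fin_cases j <;> rfl
      rw [this]; exact detEquiv_smul_one one_ne_zero ha
  · rw [matDisc, sub_eq_zero] at hd
    have hw0 : -(w : ZMod p) ≠ 0 := neg_ne_zero.2 w.ne_zero
    have h1 : (-1 : ZMod p) ≠ 0 := neg_ne_zero.2 one_ne_zero
    by_cases ht : m.trace = 0
    · have hdet : m.det = 0 := by
        rw [ht] at hd
        exact (mul_eq_zero.1 (hd.symm.trans (by ring))).resolve_left h4
      obtain hq | hq := exists_wedgeForm_neg_one_or hw hq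
      · exact ⟨.H3, detEquiv_of_wedgeForm h1 one_ne_zero
          ⟨0, 1, by simp [wedgeForm, orbitRep]⟩ hq
          (by simp [orbitRep, ht, Matrix.trace_fin_two]) (by simp [orbitRep, hdet])⟩
      · exact ⟨.H4, detEquiv_of_wedgeForm hw0 one_ne_zero
          ⟨0, 1, by simp [wedgeForm, orbitRep]⟩ hq
          (by simp [orbitRep, ht, Matrix.trace_fin_two]) (by simp [orbitRep, hdet])⟩
    -- The factor c = tr / 2 is the double eigenvalue of m, to be compared with the eigenvalue 1 of
    -- H₆ and H₇.
    · have hc : m.trace / 2 ≠ 0 := div_ne_zero ht h2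
      have ht' : m.trace = m.trace / 2 * (1 + 1) := by field_simp; ring
      have hd' : m.det = (m.trace / 2) ^ 2 * 1 := by
        apply mul_left_cancel₀ h4
        rw [← hd]; field_simp; ring
      obtain hq | hq := exists_wedgeForm_neg_one_or hw hq
      · exact ⟨.H6, detEquiv_of_wedgeForm h1 hc
          ⟨0, 1, by simp [wedgeForm, orbitRep]⟩ hq
          (by simpa [orbitRep, Matrix.trace_fin_two] using ht') (by simpa [orbitRep] using hd')⟩
      · exact ⟨.H7, detEquiv_of_wedgeForm hw0 hc
          ⟨0, 1, by simp [wedgeForm, orbitRep]⟩ hq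
          (by simpa [orbitRep, Matrix.trace_fin_two] using ht') (by simpa [orbitRep] using hd')⟩

theorem detEquiv_of_trace_det (hp : p ≠ 2) {m m' : Matrix (Fin 2) (Fin 2) (ZMod p)} {c : ZMod p}
    (hm' : matDisc m' ≠ 0) (hc : c ≠ 0) (ht : m'.trace = c * m.trace)
    (hd : m'.det = c ^ 2 * m.det) : DetEquiv m m' := by
  have hm : matDisc m ≠ 0 := by
    intro h
    apply hm'
    have : matDisc m' = c ^ 2 * matDisc m := by rw [matDisc, matDisc, ht, hd]; ring
    rw [this, h, mul_zero]
  exact detEquiv_of_wedgeForm one_ne_zero hc (exists_wedgeForm_eq hp hm 1)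
    (exists_wedgeForm_eq hp hm' 1) ht hd

theorem exists_orbitRep_of_isSquare_disc {w : (ZMod p)ˣ} (hw : ∀ x, x ∈ Subgroup.zpowers w)
    (hp : p ≠ 2) {m : Matrix (Fin 2) (Fin 2) (ZMod p)} (hd : matDisc m ≠ 0)
    (hs : IsSquare (matDisc m)) : ∃ i, DetEquiv (orbitRep w i) m := by
  have h2 := two_ne_zero_of_ne_two hp
  obtain ⟨s, hs⟩ := hs
  obtain ⟨a, b, hab, ht, hdet⟩ : ∃ a b : ZMod p, a ≠ b ∧ m.trace = a + b ∧ m.det = a * b := by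
    rw [matDisc] at hs
    -- The two eigenvalues of m, distinct because the discriminant s² is nonzero.
    refine ⟨(m.trace + s) / 2, (m.trace - s) / 2, ?_, by field_simp; ring, ?_⟩
    · intro h
      rw [div_left_inj' h2] at h
      have h3 : 2 * s = 0 := by linear_combination h
      have h4 : s = 0 := (mul_eq_zero.1 h3).resolve_left h2
      exact hd (by rw [matDisc, hs, h4, mul_zero])
    · field_simp
      linear_combination -hs
  by_cases ha : a = 0
  · exact ⟨.H2, detEquiv_of_trace_det hp hd (c := b) (by rintro rfl; exact hab ha)
      (by simp [orbitRep, Matrix.trace_fin_two, ht, ha]) (by simp [orbitRep, hdet, ha])⟩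
  by_cases hb : b = 0
  · exact ⟨.H2, detEquiv_of_trace_det hp hd (c := a) ha
      (by simp [orbitRep, Matrix.trace_fin_two, ht, hb]) (by simp [orbitRep, hdet, hb])⟩
  obtain ⟨k, hk, hk'⟩ := exists_pow_eq hw (div_ne_zero hb ha)
  have hk0 : k ≠ 0 := by
    rintro rfl
    rw [pow_zero, div_eq_one_iff_eq ha] at hk'
    exact hab hk'.symm
  have hbk : b = a * (w : ZMod p) ^ k := by rw [← hk']; field_simp
  by_cases hle : k ≤ (p - 1) / 2
  · refine ⟨.H9 k ⟨by omega, hle⟩, detEquiv_of_trace_det hp hd (c := a) ha ?_ ?_⟩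
    · simp [orbitRep, Matrix.trace_fin_two, ht, hbk]; ring
    · simp [orbitRep, hdet, hbk]; ring
  -- Exchanging the eigenvalues inverts their ratio and brings the exponent into the range of H₉.
  · have hak : a = b * (w : ZMod p) ^ (p - 1 - k) := by
      rw [hbk, mul_assoc, ← pow_add, Nat.add_sub_cancel' hk.le, ZMod.pow_card_sub_one_eq_one
        w.ne_zero, mul_one]
    refine ⟨.H9 (p - 1 - k) ⟨by omega, by omega⟩, detEquiv_of_trace_det hp hd (c := b) hb ?_ ?_⟩
    · simp only [orbitRep, Matrix.trace_fin_two_of]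
      linear_combination ht + hak
    · simp only [orbitRep, Matrix.det_fin_two_of]
      linear_combination hdet + b * hak

theorem exists_orbitRep_of_not_isSquare_disc {w : (ZMod p)ˣ} (hw : ∀ x, x ∈ Subgroup.zpowers w)
    (hp : p ≠ 2) {m : Matrix (Fin 2) (Fin 2) (ZMod p)} (hs : ¬ IsSquare (matDisc m)) :
    ∃ i, DetEquiv (orbitRep w i) m := by
  have h2 := two_ne_zero_of_ne_two hp
  have h4 := four_ne_zero_of_ne_two hp
  have hd : matDisc m ≠ 0 := fun h => hs (h ▸ IsSquare.zero)
  by_cases ht : m.trace = 0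
  · have hdisc : matDisc m = 4 * -m.det := by rw [matDisc, ht]; ring
    rw [hdisc, isSquare_four_mul hp] at hs
    have h0 : -m.det ≠ 0 := fun h => hs (h ▸ IsSquare.zero)
    obtain ⟨s, hs0, h | h⟩ := exists_eq_sq_or_eq_mul_sq hw h0
    · exact absurd ⟨s, by rw [h]; ring⟩ hs
    · refine ⟨.H8, detEquiv_of_trace_det hp hd hs0 (by simp [orbitRep, ht, Matrix.trace_fin_two]) ?_⟩
      simp only [orbitRep, Matrix.det_fin_two_of]
      linear_combination -h
  · have hc : m.trace / 2 ≠ 0 := div_ne_zero ht h2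
    -- disc / tr² is unchanged by scaling. It is a non-square, hence an odd power w^(2l+1), and
    -- equals the corresponding ratio 4w^(2l+1) / 2² for H₁₀ with parameter l.
    obtain ⟨k, hk, h⟩ := exists_pow_eq hw (div_ne_zero hd (pow_ne_zero 2 ht))
    have hdisc : matDisc m = m.trace ^ 2 * (w : ZMod p) ^ k := by rw [← h]; field_simp
    obtain ⟨l, rfl | rfl⟩ := k.even_or_odd'
    · exact absurd ⟨m.trace * (w : ZMod p) ^ l, by rw [hdisc]; ring⟩ hs
    · refine ⟨.H10 l (by omega), detEquiv_of_trace_det hp hd hc ?_ ?_⟩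
      · rw [trace_orbitRep_H10]; field_simp
      · rw [det_orbitRep_H10]
        rw [matDisc] at hdisc
        apply mul_left_cancel₀ h4
        field_simp
        linear_combination -hdisc

theorem exists_orbitRep {w : (ZMod p)ˣ} (hw : ∀ x, x ∈ Subgroup.zpowers w)
    (hp : p ≠ 2) (m : Matrix (Fin 2) (Fin 2) (ZMod p)) : ∃ i, DetEquiv (orbitRep w i) m := by
  by_cases hd : matDisc m = 0
  · exact exists_orbitRep_of_disc_eq_zero hw hp hd
  by_cases hs : IsSquare (matDisc m)
  · exact exists_orbitRep_of_isSquare_disc hw hp hd hs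
  · exact exists_orbitRep_of_not_isSquare_disc hw hp hs

theorem existsUnique_orbitRep {w : (ZMod p)ˣ} (hw : ∀ x, x ∈ Subgroup.zpowers w)
    (hp : 3 < p) (m : Matrix (Fin 2) (Fin 2) (ZMod p)) : ∃! i, DetEquiv (orbitRep w i) m := by
  obtain ⟨i, hi⟩ := exists_orbitRep hw (by omega) m
  exact ⟨i, hi, fun j hj => eq_of_detEquiv_orbitRep hw hp (hj.trans hi.symm)⟩

theorem card_descLabel (hp : p ≠ 2) : Nat.card (DescLabel p) = p + 7 := by
  obtain ⟨q, hq⟩ := (Nat.Prime.eq_two_or_odd' (Fact.out : p.Prime)).resolve_left hp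
  rw [Nat.card_congr descLabelEquiv]
  simp
  omega

theorem ncard_range_orbits {w : (ZMod p)ˣ} (hw : ∀ x, x ∈ Subgroup.zpowers w) (hp : 3 < p) :
    (Set.range fun m : Matrix (Fin 2) (Fin 2) (ZMod p) =>
      Set.range fun g : GL (Fin 2) (ZMod p) => detConj g m).ncard = p + 7 := by
  have horb (m : Matrix (Fin 2) (Fin 2) (ZMod p)) :
      (Set.range fun g : GL (Fin 2) (ZMod p) => detConj g m) = {m' | DetEquiv m m'} := by
    ext m'
    exact exists_congr fun g => eq_comm
  have hinj : Function.Injective fun i : DescLabel p => {m' | DetEquiv (orbitRep w i) m'} := by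
    intro i j h
    have : orbitRep w j ∈ {m' | DetEquiv (orbitRep w i) m'} := by
      simp only at h
      rw [h]; exact DetEquiv.refl _
    exact eq_of_detEquiv_orbitRep hw hp this
  have hrange : (Set.range fun m : Matrix (Fin 2) (Fin 2) (ZMod p) =>
      Set.range fun g : GL (Fin 2) (ZMod p) => detConj g m) =
      Set.range fun i : DescLabel p => {m' | DetEquiv (orbitRep w i) m'} := by
    simp only [horb]
    apply subset_antisymm
    · rintro _ ⟨m, rfl⟩
      obtain ⟨i, hi⟩ := exists_orbitRep hw (by omega) m
      exact ⟨i, Set.ext fun m' => ⟨fun h => hi.symm.trans h, fun h => hi.trans h⟩⟩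
    · rintro _ ⟨i, rfl⟩
      exact ⟨_, rfl⟩
  rw [hrange, ← Nat.card_coe_set_eq, Nat.card_range_of_injective hinj, card_descLabel (by omega)]

end Completeness

/-! ### The carry cocycle of ℤ/p² over ℤ/p -/

section Carry

/-- The carry of the sum of two residues modulo `p`. -/
def carry {p : ℕ} (x y : ZMod p) : ZMod p := ((x.val + y.val) / p : ℕ)

theorem carry_comm {p : ℕ} (x y : ZMod p) : carry x y = carry y x := by
  rw [carry, carry, add_comm]

variable {p : ℕ} [NeZero p]

@[simp] theorem carry_zero_right (x : ZMod p) : carry x 0 = 0 := by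
  simp [carry, Nat.div_eq_of_lt (ZMod.val_lt x)]

@[simp] theorem carry_zero_left (x : ZMod p) : carry 0 x = 0 := by
  rw [carry_comm, carry_zero_right]

theorem div_add_mod_add_div (m k : ℕ) : m / p + (m % p + k) / p = (m + k) / p := by
  conv_rhs => rw [← Nat.div_add_mod m p, add_assoc, Nat.mul_add_div (NeZero.pos p)]

theorem carry_cocycle (x y z : ZMod p) :
    carry x y + carry (x + y) z = carry y z + carry x (y + z) := by
  simp only [carry, ZMod.val_add, ← Nat.cast_add]
  rw [div_add_mod_add_div, add_comm x.val ((y.val + z.val) % p), div_add_mod_add_div]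
  congr 2
  ring

/-- The carries collected while adding n copies of x telescope to ⌊n · x.val / p⌋; at n = p this is
x itself, which is how the model acquires nontrivial p-th powers. -/
theorem carry_nsmul (x : ZMod p) (n : ℕ) :
    ((n * x.val / p : ℕ) : ZMod p) + carry ((n : ZMod p) * x) x = ((n + 1) * x.val / p : ℕ) := by
  rw [carry, ZMod.val_mul, ZMod.val_natCast, ← Nat.cast_add, Nat.mod_mul_mod, div_add_mod_add_div, add_mul, one_mul]

end Carry

/-- The group with the underlying set of the free nilpotent Lie algebra of class three on two
generators over `ZMod p`, with basis `e₁, e₂, [e₂, e₁], [[e₂, e₁], e₁], [[e₂, e₁], e₂]`. The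
multiplication is the Baker-Campbell-Hausdorff product, with carries of the first two
coordinates added to the last two through the matrix `Q`. -/
@[ext] structure Desc {p : ℕ} (Q : Matrix (Fin 2) (Fin 2) (ZMod p)) : Type where
  a : ZMod p
  b : ZMod p
  c : ZMod p
  d : ZMod p
  e : ZMod p

/-! ### The model group: group law, powers and commutators -/

namespace Desc

variable {p : ℕ} [Fact p.Prime] {Q : Matrix (Fin 2) (Fin 2) (ZMod p)}

instance : One (Desc Q) := ⟨⟨0, 0, 0, 0, 0⟩⟩

instance : Mul (Desc Q) where
  mul x y :=
    { a := x.a + y.a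
      b := x.b + y.b
      c := x.c + y.c + 2⁻¹ * (x.b * y.a - x.a * y.b)
      d := x.d + y.d + 2⁻¹ * (x.c * y.a - x.a * y.c) +
        12⁻¹ * ((y.a - x.a) * (x.b * y.a - x.a * y.b)) +
        (carry x.a y.a * Q 0 0 + carry x.b y.b * Q 1 0)
      e := x.e + y.e + 2⁻¹ * (x.c * y.b - x.b * y.c) +
        12⁻¹ * ((y.b - x.b) * (x.b * y.a - x.a * y.b)) +
        (carry x.a y.a * Q 0 1 + carry x.b y.b * Q 1 1) }

instance : Inv (Desc Q) where
  inv x :=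
    { a := -x.a
      b := -x.b
      c := -x.c
      d := -x.d - (carry (-x.a) x.a * Q 0 0 + carry (-x.b) x.b * Q 1 0)
      e := -x.e - (carry (-x.a) x.a * Q 0 1 + carry (-x.b) x.b * Q 1 1) }

@[simp] theorem one_a : (1 : Desc Q).a = 0 := rfl
@[simp] theorem one_b : (1 : Desc Q).b = 0 := rfl
@[simp] theorem one_c : (1 : Desc Q).c = 0 := rfl
@[simp] theorem one_d : (1 : Desc Q).d = 0 := rfl
@[simp] theorem one_e : (1 : Desc Q).e = 0 := rfl
@[simp] theorem mul_a (x y : Desc Q) : (x * y).a = x.a + y.a := rfl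
@[simp] theorem mul_b (x y : Desc Q) : (x * y).b = x.b + y.b := rfl
@[simp] theorem mul_c (x y : Desc Q) :
    (x * y).c = x.c + y.c + 2⁻¹ * (x.b * y.a - x.a * y.b) := rfl
@[simp] theorem mul_d (x y : Desc Q) :
    (x * y).d = x.d + y.d + 2⁻¹ * (x.c * y.a - x.a * y.c) +
      12⁻¹ * ((y.a - x.a) * (x.b * y.a - x.a * y.b)) +
      (carry x.a y.a * Q 0 0 + carry x.b y.b * Q 1 0) := rfl
@[simp] theorem mul_e (x y : Desc Q) :
    (x * y).e = x.e + y.e + 2⁻¹ * (x.c * y.b - x.b * y.c) +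
      12⁻¹ * ((y.b - x.b) * (x.b * y.a - x.a * y.b)) +
      (carry x.a y.a * Q 0 1 + carry x.b y.b * Q 1 1) := rfl
@[simp] theorem inv_a (x : Desc Q) : x⁻¹.a = -x.a := rfl
@[simp] theorem inv_b (x : Desc Q) : x⁻¹.b = -x.b := rfl
@[simp] theorem inv_c (x : Desc Q) : x⁻¹.c = -x.c := rfl
@[simp] theorem inv_d (x : Desc Q) :
    x⁻¹.d = -x.d - (carry (-x.a) x.a * Q 0 0 + carry (-x.b) x.b * Q 1 0) := rfl
@[simp] theorem inv_e (x : Desc Q) :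
    x⁻¹.e = -x.e - (carry (-x.a) x.a * Q 0 1 + carry (-x.b) x.b * Q 1 1) := rfl

theorem central_mul (x : Desc Q) (d e : ZMod p) :
    x * ⟨0, 0, 0, d, e⟩ = ⟨x.a, x.b, x.c, x.d + d, x.e + e⟩ := by
  ext <;> simp

theorem mul_central (x : Desc Q) (d e : ZMod p) :
    ⟨0, 0, 0, d, e⟩ * x = ⟨x.a, x.b, x.c, x.d + d, x.e + e⟩ := by
  ext <;> simp [add_comm]

/-- The group `Desc Q` as a set. -/
def equivProd : Desc Q ≃ (Fin 5 → ZMod p) where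
  toFun x := ![x.a, x.b, x.c, x.d, x.e]
  invFun f := ⟨f 0, f 1, f 2, f 3, f 4⟩
  left_inv x := rfl
  right_inv f := by ext i; fin_cases i <;> rfl

instance : Finite (Desc Q) := Finite.of_equiv _ equivProd.symm

theorem card : Nat.card (Desc Q) = p ^ 5 := by
  rw [Nat.card_congr equivProd]; simp

variable [hp : Fact (3 < p)]

theorem two_mul_six_mul_inv : (2 : ZMod p)⁻¹ = 6 * 12⁻¹ ∧ (12 : ZMod p) * 12⁻¹ = 1 := by
  have h2 := two_ne_zero_of_ne_two (p := p) (by have := hp.out; omega)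
  have h3 : (3 : ZMod p) ≠ 0 := by
    intro h
    have : ((3 : ℕ) : ZMod p) = 0 := by exact_mod_cast h
    rw [ZMod.natCast_eq_zero_iff] at this
    have := (Nat.prime_dvd_prime_iff_eq Fact.out Nat.prime_three).1 this
    have := hp.out
    omega
  have h12 : (12 : ZMod p) ≠ 0 := by
    have : (12 : ZMod p) = 2 * 2 * 3 := by norm_num
    rw [this]; positivity
  refine ⟨?_, mul_inv_cancel₀ h12⟩
  field_simp
  norm_num

protected theorem mul_assoc (x y z : Desc Q) : x * y * z = x * (y * z) := by
  obtain ⟨h2, h12⟩ := two_mul_six_mul_inv (p := p)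
  have ca := carry_cocycle x.a y.a z.a
  have cb := carry_cocycle x.b y.b z.b
  ext
  · simp [add_assoc]
  · simp [add_assoc]
  · simp; ring
  · simp only [mul_d, mul_a, mul_b, mul_c, h2]
    generalize (12 : ZMod p)⁻¹ = t at h12 ⊢
    -- The carry terms cancel by the cocycle identity. With 1/2 = 6t, the nested products contribute
    -- 36t², which 12t = 1 turns into 3t.
    linear_combination Q 0 0 * ca + Q 1 0 * cb + 3 * t * ((x.b * y.a - x.a * y.b) * z.a +
      x.a * (y.b * z.a - y.a * z.b)) * h12
  · simp only [mul_e, mul_a, mul_b, mul_c, h2]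
    generalize (12 : ZMod p)⁻¹ = t at h12 ⊢
    linear_combination Q 0 1 * ca + Q 1 1 * cb + 3 * t * ((x.b * y.a - x.a * y.b) * z.b +
      x.b * (y.b * z.a - y.a * z.b)) * h12

instance : Group (Desc Q) :=
  Group.ofLeftAxioms Desc.mul_assoc
    (fun x => by ext <;> simp)
    (fun x => by
      ext
      · simp
      · simp
      · simp [mul_comm]
      · simp; ring
      · simp; ring)

/-- The Lie brackets of x with its own multiples vanish, so powers are scalar multiples apart from
the accumulated carries. -/
theorem pow_eq (x : Desc Q) (n : ℕ) : x ^ n =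
    { a := n * x.a
      b := n * x.b
      c := n * x.c
      d := n * x.d + ((n * x.a.val / p : ℕ) * Q 0 0 + (n * x.b.val / p : ℕ) * Q 1 0)
      e := n * x.e + ((n * x.a.val / p : ℕ) * Q 0 1 + (n * x.b.val / p : ℕ) * Q 1 1) } := by
  induction n with
  | zero => ext <;> simp
  | succ n ih =>
    rw [pow_succ, ih]
    ext
    · simp; ring
    · simp; ring
    · simp; ring
    · simp only [mul_d, ← carry_nsmul]; push_cast; ring
    · simp only [mul_e, ← carry_nsmul]; push_cast; ring

theorem pow_prime (x : Desc Q) : x ^ p =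
    ⟨0, 0, 0, x.a * Q 0 0 + x.b * Q 1 0, x.a * Q 0 1 + x.b * Q 1 1⟩ := by
  have hp0 : 0 < p := NeZero.pos p
  rw [pow_eq]
  simp [Nat.mul_div_cancel_left _ hp0]

theorem central_pow (d e : ZMod p) (n : ℕ) :
    (⟨0, 0, 0, d, e⟩ : Desc Q) ^ n = ⟨0, 0, 0, n * d, n * e⟩ := by
  rw [pow_eq]; simp

theorem eq_rcomm_of_mul_eq {G : Type*} [Group G] {x y z : G} (h : x * y = y * x * z) :
    rcomm x y = z := by
  rw [rcomm, mul_assoc _ x y, h]; group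

theorem rcomm_a (x y : Desc Q) : (rcomm x y).a = 0 := by simp [rcomm]

theorem rcomm_b (x y : Desc Q) : (rcomm x y).b = 0 := by simp [rcomm]

theorem rcomm_c (x y : Desc Q) : (rcomm x y).c = x.b * y.a - x.a * y.b := by
  obtain ⟨h2, h12⟩ := two_mul_six_mul_inv (p := p)
  simp [rcomm, h2]
  linear_combination (x.b * y.a - x.a * y.b) * h12

theorem rcomm_of_eq_zero {x : Desc Q} (ha : x.a = 0) (hb : x.b = 0) (y : Desc Q) :
    rcomm x y = ⟨0, 0, 0, x.c * y.a, x.c * y.b⟩ := by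
  obtain ⟨h2, h12⟩ := two_mul_six_mul_inv (p := p)
  apply eq_rcomm_of_mul_eq
  rw [central_mul]
  ext
  · simp [add_comm]
  · simp [add_comm]
  · simp [ha, hb, add_comm]
  · simp [ha, hb, h2]
    linear_combination (x.c * y.a) * h12
  · simp [ha, hb, h2]
    linear_combination (x.c * y.b) * h12

end Desc

/-! ### Commutators and upper bounds for orders -/

section GroupTheory

theorem map_rcomm {G H : Type*} [Group G] [Group H] (f : G →* H) (x y : G) :
    f (rcomm x y) = rcomm (f x) (f y) := by
  simp [rcomm]

theorem mul_eq_mul_mul_rcomm {G : Type*} [Group G] (x y : G) : x * y = y * x * rcomm x y := by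
  simp [rcomm, mul_assoc]

theorem rcomm_eq_one_iff {G : Type*} [Group G] {x y : G} : rcomm x y = 1 ↔ Commute x y := by
  constructor
  · intro h
    have := mul_eq_mul_mul_rcomm x y
    rwa [h, mul_one] at this
  · intro h
    exact Desc.eq_rcomm_of_mul_eq (by rw [mul_one, h.eq])

theorem zpow_eq_pow_val {p : ℕ} [NeZero p] {G : Type*} [Group G] {x : G} (hx : x ^ p = 1) (i : ℤ) :
    x ^ i = x ^ (i : ZMod p).val := by
  rw [← zpow_natCast x, ZMod.val_intCast]
  conv_lhs => rw [← Int.emod_add_mul_ediv i p, zpow_add, zpow_mul, zpow_natCast, hx, one_zpow, mul_one]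

theorem exists_zpow_mul_zpow {G : Type*} [Group G] {x y z : G} (hxy : Commute x y)
    (hz : z ∈ Subgroup.closure {x, y}) : ∃ i j : ℤ, z = x ^ i * y ^ j := by
  induction hz using Subgroup.closure_induction with
  | mem z hz =>
    obtain rfl | rfl := hz
    · exact ⟨1, 0, by simp⟩
    · exact ⟨0, 1, by simp⟩
  | one => exact ⟨0, 0, by simp⟩
  | mul a b _ _ ha hb =>
    obtain ⟨i, j, rfl⟩ := ha
    obtain ⟨k, l, rfl⟩ := hb
    refine ⟨i + k, j + l, ?_⟩
    rw [zpow_add, zpow_add, mul_assoc, mul_assoc, ← mul_assoc (y ^ j),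
      ((hxy.zpow_zpow k j).eq).symm, mul_assoc]
  | inv a _ ha =>
    obtain ⟨i, j, rfl⟩ := ha
    refine ⟨-i, -j, ?_⟩
    rw [mul_inv_rev, zpow_neg, zpow_neg, ((hxy.zpow_zpow i j).inv_inv).eq]

theorem exists_zmodPow_mul_zmodPow {p : ℕ} [NeZero p] {G : Type*} [Group G] {x y z : G}
    (hxy : Commute x y) (hx : x ^ p = 1) (hy : y ^ p = 1) (hz : z ∈ Subgroup.closure {x, y}) :
    ∃ i j : ZMod p, z = zmodPow x i * zmodPow y j := by
  obtain ⟨i, j, rfl⟩ := exists_zpow_mul_zpow hxy hz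
  exact ⟨i, j, by rw [zpow_eq_pow_val hx, zpow_eq_pow_val hy, zmodPow, zmodPow]⟩

theorem card_closure_pair_le {p : ℕ} [NeZero p] {G : Type*} [Group G] {x y : G}
    (hxy : Commute x y) (hx : x ^ p = 1) (hy : y ^ p = 1) :
    Finite (Subgroup.closure {x, y}) ∧ Nat.card (Subgroup.closure {x, y}) ≤ p ^ 2 := by
  have hmem (i j : ZMod p) : zmodPow x i * zmodPow y j ∈ Subgroup.closure {x, y} :=
    mul_mem (pow_mem (Subgroup.subset_closure (by simp)) _)
      (pow_mem (Subgroup.subset_closure (by simp)) _)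
  have hsurj : Function.Surjective
      fun i : ZMod p × ZMod p => (⟨_, hmem i.1 i.2⟩ : Subgroup.closure {x, y}) := by
    rintro ⟨z, hz⟩
    obtain ⟨i, j, rfl⟩ := exists_zmodPow_mul_zmodPow hxy hx hy hz
    exact ⟨(i, j), rfl⟩
  refine ⟨Finite.of_surjective _ hsurj, ?_⟩
  have := Nat.card_le_card_of_surjective _ hsurj
  simpa [sq] using this

theorem card_le_of_quotient {G : Type*} [Group G] (N : Subgroup G) {m n : ℕ} [Finite N]
    [Finite (G ⧸ N)] (hN : Nat.card N ≤ m) (hQ : Nat.card (G ⧸ N) ≤ n) :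
    Finite G ∧ Nat.card G ≤ n * m := by
  constructor
  · exact Finite.of_equiv _ (Subgroup.groupEquivQuotientProdSubgroup (s := N)).symm
  · rw [N.card_eq_card_quotient_mul_card_subgroup]
    exact Nat.mul_le_mul hQ hN

theorem closure_image_mk_eq_top {G : Type*} [Group G] (N : Subgroup G) [N.Normal] {s : Set G}
    (hs : Subgroup.closure s = ⊤) : Subgroup.closure (QuotientGroup.mk' N '' s) = ⊤ := by
  rw [← MonoidHom.map_closure, hs, ← MonoidHom.range_eq_map, QuotientGroup.range_mk']

theorem normal_of_le_center {G : Type*} [Group G] {N : Subgroup G} (h : N ≤ Subgroup.center G) :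
    N.Normal := by
  refine ⟨fun n hn g => ?_⟩
  rw [Subgroup.mem_center_iff.1 (h hn) g, mul_inv_cancel_right]
  exact hn

theorem mem_center_of_closure {G : Type*} [Group G] {s : Set G} (hs : Subgroup.closure s = ⊤) {z : G}
    (hz : ∀ x ∈ s, Commute z x) : z ∈ Subgroup.center G := by
  rw [Subgroup.mem_center_iff]
  intro g
  have : s ⊆ Subgroup.centralizer {z} := by
    intro x hx
    rw [SetLike.mem_coe, Subgroup.mem_centralizer_singleton_iff]
    exact (hz x hx).symm.eq
  have hg : g ∈ Subgroup.centralizer {z} := (Subgroup.closure_le _).2 this (hs ▸ Subgroup.mem_top g)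
  exact Subgroup.mem_centralizer_singleton_iff.1 hg

theorem card_le_cube {p : ℕ} [NeZero p] {G : Type*} [Group G] {x y z : G}
    (hG : Subgroup.closure {x, y, z} = ⊤) (hx : x ^ p = 1) (hy : y ^ p = 1) (hz : z ^ p = 1)
    (hyx : rcomm y x = z) (hzx : Commute z x) (hzy : Commute z y) :
    Finite G ∧ Nat.card G ≤ p ^ 3 := by
  have hcen : z ∈ Subgroup.center G := mem_center_of_closure hG (by
    rintro _ (rfl | rfl | rfl)
    exacts [hzx, hzy, Commute.refl _])
  have hle : Subgroup.zpowers z ≤ Subgroup.center G := by simpa using hcen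
  have : (Subgroup.zpowers z).Normal := normal_of_le_center hle
  have hfin : Finite (Subgroup.zpowers z) := by
    exact finite_zpowers.2 (isOfFinOrder_iff_pow_eq_one.2 ⟨p, NeZero.pos p, hz⟩)
  let f := QuotientGroup.mk' (Subgroup.zpowers z)
  have hfz : f z = 1 := (QuotientGroup.eq_one_iff z).2 (Subgroup.mem_zpowers z)
  have hcomm : Commute (f x) (f y) := by
    apply Commute.symm
    rw [← rcomm_eq_one_iff, ← map_rcomm, hyx, hfz]
  have htop : Subgroup.closure {f x, f y} = ⊤ := by
    have := closure_image_mk_eq_top (Subgroup.zpowers z) hG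
    rw [eq_top_iff, ← this, Subgroup.closure_le]
    rintro _ ⟨g, rfl | rfl | rfl, rfl⟩
    · exact Subgroup.subset_closure (by simp [f])
    · exact Subgroup.subset_closure (by simp [f])
    · change f _ ∈ _
      rw [hfz]; exact one_mem _
  obtain ⟨h1, h2⟩ := card_closure_pair_le (p := p) hcomm (by rw [← map_pow, hx, map_one])
    (by rw [← map_pow, hy, map_one])
  rw [htop] at h1 h2
  rw [Subgroup.card_top] at h2
  have : Finite (G ⧸ Subgroup.zpowers z) := Subgroup.topEquiv.toEquiv.finite_iff.1 h1
  obtain ⟨h3, h4⟩ := card_le_of_quotient (Subgroup.zpowers z) (m := p) (n := p ^ 2) (by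
    rw [Nat.card_zpowers]; exact orderOf_le_of_pow_eq_one (NeZero.pos p) hz) h2
  exact ⟨h3, h4.trans_eq (by ring)⟩

/-- Modulo the central subgroup Z the generators satisfy the Heisenberg relations, so the quotient
has order at most p³. -/
theorem card_le_of_central {p m : ℕ} [NeZero p] {G : Type*} [Group G] {x y z : G} {Z : Subgroup G}
    [Finite Z] (hZ : Nat.card Z ≤ m) (hcen : Z ≤ Subgroup.center G)
    (hG : Subgroup.closure ({x, y, z} ∪ (Z : Set G)) = ⊤) (hx : x ^ p ∈ Z) (hy : y ^ p ∈ Z)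
    (hz : z ^ p ∈ Z) (hyx : rcomm y x = z) (hzx : rcomm z x ∈ Z) (hzy : rcomm z y ∈ Z) :
    Finite G ∧ Nat.card G ≤ p ^ 3 * m := by
  have : Z.Normal := normal_of_le_center hcen
  let f := QuotientGroup.mk' Z
  have hf {g : G} (hg : g ∈ Z) : f g = 1 := (QuotientGroup.eq_one_iff g).2 hg
  have htop : Subgroup.closure {f x, f y, f z} = ⊤ := by
    have := closure_image_mk_eq_top Z hG
    rw [eq_top_iff, ← this, Subgroup.closure_le]
    rintro _ ⟨g, (rfl | rfl | rfl) | hg, rfl⟩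
    · exact Subgroup.subset_closure (by simp [f])
    · exact Subgroup.subset_closure (by simp [f])
    · exact Subgroup.subset_closure (by simp [f])
    · change f _ ∈ _
      rw [hf hg]; exact one_mem _
  obtain ⟨h1, h2⟩ := card_le_cube (p := p) htop (by rw [← map_pow, hf hx])
    (by rw [← map_pow, hf hy]) (by rw [← map_pow, hf hz]) (by rw [← map_rcomm, hyx])
    (by rw [← rcomm_eq_one_iff, ← map_rcomm, hf hzx])
    (by rw [← rcomm_eq_one_iff, ← map_rcomm, hf hzy])
  exact card_le_of_quotient Z hZ h2

end GroupTheory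

/-! ### Power-commutator presentations -/

section Presentations

variable {p n : ℕ} {pow : Fin n → FreeGroup (Fin n)} {comm : Fin n → Fin n → FreeGroup (Fin n)}

theorem presented_pow (i : Fin n) : (PresentedGroup.of i : PresentedGroup (pcRelators p pow comm)) ^ p
    = PresentedGroup.mk _ (pow i) := by
  rw [PresentedGroup.of, ← map_pow]
  exact PresentedGroup.mk_eq_mk_of_mul_inv_mem (.inl ⟨i, rfl⟩)

theorem presented_rcomm {i j : Fin n} (hij : i < j) :
    rcomm (PresentedGroup.of j : PresentedGroup (pcRelators p pow comm)) (PresentedGroup.of i)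
    = PresentedGroup.mk _ (comm j i) := by
  rw [PresentedGroup.of, PresentedGroup.of, ← map_rcomm]
  exact PresentedGroup.mk_eq_mk_of_mul_inv_mem (.inr ⟨i, j, hij, rfl⟩)

theorem lift_pcRelators {H : Type*} [Group H] {h : Fin n → H}
    (hpow : ∀ i, h i ^ p = FreeGroup.lift h (pow i))
    (hcomm : ∀ i j, i < j → rcomm (h j) (h i) = FreeGroup.lift h (comm j i)) :
    ∀ r ∈ pcRelators p pow comm, FreeGroup.lift h r = 1 := by
  rintro r (⟨i, rfl⟩ | ⟨i, j, hij, rfl⟩)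
  · rw [map_mul, map_pow, FreeGroup.lift_apply_of, hpow, ← map_mul, mul_inv_cancel, map_one]
  · rw [map_mul, map_rcomm, FreeGroup.lift_apply_of, FreeGroup.lift_apply_of, hcomm i j hij,
      ← map_mul, mul_inv_cancel, map_one]

end Presentations

/-! ### The presented groups of order at most p^5 -/

section OrderFive

/-- The words in the last two generators. -/
def centralWords : Subgroup (FreeGroup (Fin 5)) := Subgroup.closure {genFour, genFive}

theorem card_groupOrderFive_le {p : ℕ} [NeZero p] {c₁ c₂ q₁ q₂ : FreeGroup (Fin 5)}
    (hc₁ : c₁ ∈ centralWords) (hc₂ : c₂ ∈ centralWords) (hq₁ : q₁ ∈ centralWords)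
    (hq₂ : q₂ ∈ centralWords) :
    Finite (GroupOrderFive p c₁ c₂ q₁ q₂) ∧ Nat.card (GroupOrderFive p c₁ c₂ q₁ q₂) ≤ p ^ 5 := by
  let x (i : Fin 5) : GroupOrderFive p c₁ c₂ q₁ q₂ := PresentedGroup.of i
  have htop : Subgroup.closure (Set.range x) = ⊤ := PresentedGroup.closure_range_of _
  have comm {i j : Fin 5} (hij : i < j) := presented_rcomm (p := p) (pow := ![q₁, q₂, 1, 1, 1])
    (comm := ![![1, 1, 1, 1, 1], ![FreeGroup.of (2 : Fin 5), 1, 1, 1, 1], ![c₁, c₂, 1, 1, 1],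
      ![1, 1, 1, 1, 1], ![1, 1, 1, 1, 1]]) hij
  have pow (i : Fin 5) := presented_pow (p := p) (pow := ![q₁, q₂, 1, 1, 1])
    (comm := ![![1, 1, 1, 1, 1], ![FreeGroup.of (2 : Fin 5), 1, 1, 1, 1], ![c₁, c₂, 1, 1, 1],
      ![1, 1, 1, 1, 1], ![1, 1, 1, 1, 1]]) i
  have h30 : Commute (x 3) (x 0) := rcomm_eq_one_iff.1 (comm (by decide))
  have h31 : Commute (x 3) (x 1) := rcomm_eq_one_iff.1 (comm (by decide))
  have h32 : Commute (x 3) (x 2) := rcomm_eq_one_iff.1 (comm (by decide))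
  have h40 : Commute (x 4) (x 0) := rcomm_eq_one_iff.1 (comm (by decide))
  have h41 : Commute (x 4) (x 1) := rcomm_eq_one_iff.1 (comm (by decide))
  have h42 : Commute (x 4) (x 2) := rcomm_eq_one_iff.1 (comm (by decide))
  have h43 : Commute (x 4) (x 3) := rcomm_eq_one_iff.1 (comm (by decide))
  have hc3 : x 3 ∈ Subgroup.center _ := mem_center_of_closure htop (by
    rintro _ ⟨i, rfl⟩
    fin_cases i
    exacts [h30, h31, h32, Commute.refl _, h43.symm])
  have hc4 : x 4 ∈ Subgroup.center _ := mem_center_of_closure htop (by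
    rintro _ ⟨i, rfl⟩
    fin_cases i
    exacts [h40, h41, h42, h43, Commute.refl _])
  have hw {c : FreeGroup (Fin 5)} (hc : c ∈ centralWords) :
      PresentedGroup.mk _ c ∈ Subgroup.closure {x 3, x 4} := by
    have h := Subgroup.mem_map_of_mem (PresentedGroup.mk (pcRelators p ![q₁, q₂, 1, 1, 1]
      ![![1, 1, 1, 1, 1], ![FreeGroup.of (2 : Fin 5), 1, 1, 1, 1], ![c₁, c₂, 1, 1, 1],
      ![1, 1, 1, 1, 1], ![1, 1, 1, 1, 1]])) hc
    rwa [centralWords, MonoidHom.map_closure, Set.image_pair] at h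
  obtain ⟨hfin, hcard⟩ := card_closure_pair_le h43.symm (pow 3) (pow 4)
  have := card_le_of_central hcard
    ((Subgroup.closure_le _).2 (by rintro _ (rfl | rfl) <;> assumption))
    (x := x 0) (y := x 1) (z := x 2) (p := p) (by
      rw [eq_top_iff, ← htop, Subgroup.closure_le]
      rintro _ ⟨i, rfl⟩
      fin_cases i
      · exact Subgroup.subset_closure (.inl (.inl rfl))
      · exact Subgroup.subset_closure (.inl (.inr (.inl rfl)))
      · exact Subgroup.subset_closure (.inl (.inr (.inr rfl)))
      · exact Subgroup.subset_closure (.inr (Subgroup.subset_closure (.inl rfl)))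
      · exact Subgroup.subset_closure (.inr (Subgroup.subset_closure (.inr rfl))))
    (by rw [show x 0 ^ p = _ from pow 0]; exact hw hq₁)
    (by rw [show x 1 ^ p = _ from pow 1]; exact hw hq₂)
    (by rw [show x 2 ^ p = _ from pow 2]; exact one_mem _)
    (comm (i := 0) (j := 1) (by decide))
    (by rw [show rcomm (x 2) (x 0) = _ from comm (by decide)]; exact hw hc₁)
    (by rw [show rcomm (x 2) (x 1) = _ from comm (by decide)]; exact hw hc₂)
  exact ⟨this.1, this.2.trans_eq (by ring)⟩

theorem card_groupD_le {p : ℕ} [NeZero p] :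
    Finite (GroupD p) ∧ Nat.card (GroupD p) ≤ p ^ 3 := by
  let x (i : Fin 3) : GroupD p := PresentedGroup.of i
  have htop : Subgroup.closure (Set.range x) = ⊤ := PresentedGroup.closure_range_of _
  have comm {i j : Fin 3} (hij : i < j) := presented_rcomm (p := p) (pow := ![1, 1, 1])
    (comm := ![![1, 1, 1], ![FreeGroup.of (2 : Fin 3), 1, 1], ![1, 1, 1]]) hij
  have pow (i : Fin 3) := presented_pow (p := p) (pow := ![1, 1, 1])
    (comm := ![![1, 1, 1], ![FreeGroup.of (2 : Fin 3), 1, 1], ![1, 1, 1]]) i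
  refine card_le_cube (p := p) (x := x 0) (y := x 1) (z := x 2) ?_ (pow 0) (pow 1) (pow 2)
    (comm (i := 0) (j := 1) (by decide)) (rcomm_eq_one_iff.1 (comm (by decide)))
    (rcomm_eq_one_iff.1 (comm (by decide)))
  rw [eq_top_iff, ← htop, Subgroup.closure_le]
  rintro _ ⟨i, rfl⟩
  apply Subgroup.subset_closure
  fin_cases i <;> simp

/-- The elements `h` satisfy the relations of `GroupOrderFive p c₁ c₂ q₁ q₂`. -/
structure OrderFiveRelations (p : ℕ) (c₁ c₂ q₁ q₂ : FreeGroup (Fin 5)) {H : Type*} [Group H]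
    (h : Fin 5 → H) : Prop where
  comm_one_zero : rcomm (h 1) (h 0) = h 2
  comm_two_zero : rcomm (h 2) (h 0) = FreeGroup.lift h c₁
  comm_two_one : rcomm (h 2) (h 1) = FreeGroup.lift h c₂
  pow_zero : h 0 ^ p = FreeGroup.lift h q₁
  pow_one : h 1 ^ p = FreeGroup.lift h q₂
  pow_two : h 2 ^ p = 1
  pow_three : h 3 ^ p = 1
  pow_four : h 4 ^ p = 1
  center_three : h 3 ∈ Subgroup.center H
  center_four : h 4 ∈ Subgroup.center H

theorem OrderFiveRelations.lift_eq_one {p : ℕ} {c₁ c₂ q₁ q₂ : FreeGroup (Fin 5)} {H : Type*}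
    [Group H] {h : Fin 5 → H} (hh : OrderFiveRelations p c₁ c₂ q₁ q₂ h) :
    ∀ r ∈ pcRelators p ![q₁, q₂, 1, 1, 1]
      ![![1, 1, 1, 1, 1], ![FreeGroup.of (2 : Fin 5), 1, 1, 1, 1], ![c₁, c₂, 1, 1, 1],
      ![1, 1, 1, 1, 1], ![1, 1, 1, 1, 1]], FreeGroup.lift h r = 1 := by
  have h3 (g : H) : rcomm (h 3) g = 1 :=
    rcomm_eq_one_iff.2 (Subgroup.mem_center_iff.1 hh.center_three g).symm
  have h4 (g : H) : rcomm (h 4) g = 1 :=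
    rcomm_eq_one_iff.2 (Subgroup.mem_center_iff.1 hh.center_four g).symm
  apply lift_pcRelators
  · intro i
    fin_cases i
    · exact hh.pow_zero
    · exact hh.pow_one
    · exact hh.pow_two.trans (map_one _).symm
    · exact hh.pow_three.trans (map_one _).symm
    · exact hh.pow_four.trans (map_one _).symm
  · intro i j hij
    fin_cases j <;> fin_cases i <;> first
      | exact absurd hij (by decide)
      | exact hh.comm_one_zero.trans (FreeGroup.lift_apply_of).symm
      | exact hh.comm_two_zero
      | exact hh.comm_two_one
      | exact (h3 _).trans (map_one _).symm
      | exact (h4 _).trans (map_one _).symm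

/-- The relations give a surjection from the presented group, whose order is at most p^5, onto a
group of order exactly p^5; counting makes it bijective. -/
theorem OrderFiveRelations.nonempty_mulEquiv {p : ℕ} [NeZero p] {c₁ c₂ q₁ q₂ : FreeGroup (Fin 5)}
    {H : Type*} [Group H] {h : Fin 5 → H} (hh : OrderFiveRelations p c₁ c₂ q₁ q₂ h)
    (hc₁ : c₁ ∈ centralWords) (hc₂ : c₂ ∈ centralWords) (hq₁ : q₁ ∈ centralWords)
    (hq₂ : q₂ ∈ centralWords) (hH : Nat.card H = p ^ 5)
    (htop : Subgroup.closure (Set.range h) = ⊤) :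
    Nonempty (GroupOrderFive p c₁ c₂ q₁ q₂ ≃* H) := by
  obtain ⟨hfin, hcard⟩ := card_groupOrderFive_le (p := p) hc₁ hc₂ hq₁ hq₂
  have hsurj : Function.Surjective (PresentedGroup.toGroup hh.lift_eq_one) := by
    rw [← MonoidHom.range_eq_top, eq_top_iff, ← htop, Subgroup.closure_le]
    rintro _ ⟨i, rfl⟩
    exact ⟨PresentedGroup.of i, PresentedGroup.toGroup.of _⟩
  exact ⟨MulEquiv.ofBijective _ (hsurj.bijective_of_nat_card_le (hH ▸ hcard))⟩

end OrderFive

theorem zmodPow_zero {p : ℕ} {G : Type*} [Group G] (x : G) : zmodPow x (0 : ZMod p) = 1 := by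
  simp [zmodPow]

theorem zmodPow_one {p : ℕ} [Fact p.Prime] {G : Type*} [Group G] (x : G) :
    zmodPow x (1 : ZMod p) = x := by
  have : Fact (1 < p) := ⟨(Fact.out : p.Prime).one_lt⟩
  simp [zmodPow, ZMod.val_one]

theorem map_zmodPow {p : ℕ} {G H : Type*} [Group G] [Group H] (f : G →* H) (x : G) (a : ZMod p) :
    f (zmodPow x a) = zmodPow (f x) a := by
  simp [zmodPow]

theorem zmodPow_mem {p : ℕ} {G : Type*} [Group G] {K : Subgroup G} {x : G} (hx : x ∈ K)
    (a : ZMod p) : zmodPow x a ∈ K := pow_mem hx _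

/-- The word `h₄ ^ u * h₅ ^ v`. -/
def rowWord {p : ℕ} (u v : ZMod p) : FreeGroup (Fin 5) := zmodPow genFour u * zmodPow genFive v

theorem genFour_mem : genFour ∈ centralWords := Subgroup.subset_closure (.inl rfl)

theorem genFive_mem : genFive ∈ centralWords := Subgroup.subset_closure (.inr rfl)

theorem rowWord_mem {p : ℕ} (u v : ZMod p) : rowWord u v ∈ centralWords :=
  mul_mem (zmodPow_mem genFour_mem u) (zmodPow_mem genFive_mem v)

theorem lift_rowWord {p : ℕ} {H : Type*} [Group H] (h : Fin 5 → H) (u v : ZMod p) :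
    FreeGroup.lift h (rowWord u v) = zmodPow (h 3) u * zmodPow (h 4) v := by
  rw [rowWord, map_mul, map_zmodPow, map_zmodPow, FreeGroup.lift_apply_of,
    FreeGroup.lift_apply_of]

theorem exists_combination {F : Type*} [Field F] {x₁ x₂ y₁ y₂ : F} (h : x₁ * y₂ - x₂ * y₁ ≠ 0)
    (d e : F) : ∃ i j, i * x₁ + j * y₁ = d ∧ i * x₂ + j * y₂ = e := by
  refine ⟨(d * y₂ - e * y₁) / (x₁ * y₂ - x₂ * y₁), (x₁ * e - x₂ * d) / (x₁ * y₂ - x₂ * y₁), ?_, ?_⟩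
  all_goals
    rw [div_mul_eq_mul_div, div_mul_eq_mul_div, ← add_div, div_eq_iff h]
    ring

/-! ### Presentations and isomorphisms of the model groups -/

namespace Desc

variable {p : ℕ} [Fact p.Prime] {Q : Matrix (Fin 2) (Fin 2) (ZMod p)} [hp : Fact (3 < p)]

theorem zmodPow_central (d e u : ZMod p) :
    zmodPow (⟨0, 0, 0, d, e⟩ : Desc Q) u = ⟨0, 0, 0, u * d, u * e⟩ := by
  rw [zmodPow, central_pow, ZMod.natCast_zmod_val]

theorem zmodPow_central_mul_zmodPow_central (d e d' e' u v : ZMod p) :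
    zmodPow (⟨0, 0, 0, d, e⟩ : Desc Q) u * zmodPow (⟨0, 0, 0, d', e'⟩ : Desc Q) v =
      ⟨0, 0, 0, u * d + v * d', u * e + v * e'⟩ := by
  rw [zmodPow_central, zmodPow_central, central_mul]

theorem central_mem_center (d e : ZMod p) : (⟨0, 0, 0, d, e⟩ : Desc Q) ∈ Subgroup.center (Desc Q) := by
  rw [Subgroup.mem_center_iff]
  intro g
  rw [central_mul, mul_central]

theorem zmodPow_a (x : Desc Q) (u : ZMod p) : (zmodPow x u).a = u * x.a := by
  rw [zmodPow, pow_eq, ZMod.natCast_zmod_val]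

theorem zmodPow_b (x : Desc Q) (u : ZMod p) : (zmodPow x u).b = u * x.b := by
  rw [zmodPow, pow_eq, ZMod.natCast_zmod_val]

theorem zmodPow_c (x : Desc Q) (u : ZMod p) : (zmodPow x u).c = u * x.c := by
  rw [zmodPow, pow_eq, ZMod.natCast_zmod_val]

/-- A Frattini-type argument by layers: x and y give the first two coordinates, [y, x] the third,
and the commutators of [y, x] with x and y the last two. -/
theorem closure_pair_eq_top {x y : Desc Q} (h : x.a * y.b - x.b * y.a ≠ 0) :
    Subgroup.closure {x, y} = ⊤ := by
  have hx : x ∈ Subgroup.closure {x, y} := Subgroup.subset_closure (by simp)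
  have hy : y ∈ Subgroup.closure {x, y} := Subgroup.subset_closure (by simp)
  have hcomm {s t : Desc Q} (hs : s ∈ Subgroup.closure {x, y}) (ht : t ∈ Subgroup.closure {x, y}) :
      rcomm s t ∈ Subgroup.closure {x, y} :=
    mul_mem (mul_mem (mul_mem (inv_mem hs) (inv_mem ht)) hs) ht
  have hz := hcomm hy hx
  have hzc : (rcomm y x).c ≠ 0 := by
    rw [rcomm_c]; convert h using 1; ring
  have hcen (d e : ZMod p) : (⟨0, 0, 0, d, e⟩ : Desc Q) ∈ Subgroup.closure {x, y} := by
    -- The commutators of [y, x] with x and y are the (a, b)-coordinates of x and y multiplied by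
    -- the third coordinate of [y, x], hence the division.
    obtain ⟨i, j, rfl, rfl⟩ := exists_combination h (d / (rcomm y x).c) (e / (rcomm y x).c)
      |>.imp fun i => Exists.imp fun j hij => (⟨(eq_div_iff hzc).1 hij.1,
        (eq_div_iff hzc).1 hij.2⟩ : _ ∧ _)
    have h1 := mul_mem (zmodPow_mem (hcomm hz hx) i) (zmodPow_mem (hcomm hz hy) j)
    rw [rcomm_of_eq_zero (rcomm_a y x) (rcomm_b y x), rcomm_of_eq_zero (rcomm_a y x) (rcomm_b y x),
      zmodPow_central_mul_zmodPow_central] at h1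
    convert h1 using 2 <;> ring
  rw [eq_top_iff]
  rintro g -
  obtain ⟨i, j, hi, hj⟩ := exists_combination h g.a g.b
  have ht := mul_mem (zmodPow_mem hx i) (zmodPow_mem hy j)
  have hta : (zmodPow x i * zmodPow y j).a = g.a := by rw [mul_a, zmodPow_a, zmodPow_a, hi]
  have htb : (zmodPow x i * zmodPow y j).b = g.b := by rw [mul_b, zmodPow_b, zmodPow_b, hj]
  generalize zmodPow x i * zmodPow y j = t at *
  have hk := zmodPow_mem hz ((t⁻¹ * g).c / (rcomm y x).c)
  have hka := zmodPow_a (rcomm y x) ((t⁻¹ * g).c / (rcomm y x).c)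
  have hkb := zmodPow_b (rcomm y x) ((t⁻¹ * g).c / (rcomm y x).c)
  have hkc := zmodPow_c (rcomm y x) ((t⁻¹ * g).c / (rcomm y x).c)
  rw [rcomm_a, mul_zero] at hka
  rw [rcomm_b, mul_zero] at hkb
  rw [div_mul_cancel₀ _ hzc] at hkc
  generalize zmodPow (rcomm y x) ((t⁻¹ * g).c / (rcomm y x).c) = k at *
  have hg : k⁻¹ * (t⁻¹ * g) = ⟨0, 0, 0, (k⁻¹ * (t⁻¹ * g)).d, (k⁻¹ * (t⁻¹ * g)).e⟩ := by
    ext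
    · simp [hka, hta]
    · simp [hkb, htb]
    · rw [mul_c, inv_c, hkc]
      simp [hka, hkb]
      ring
    · rfl
    · rfl
  have h2 := hcen (k⁻¹ * (t⁻¹ * g)).d (k⁻¹ * (t⁻¹ * g)).e
  rw [← hg] at h2
  have := mul_mem ht (mul_mem hk h2)
  rwa [mul_inv_cancel_left, mul_inv_cancel_left] at this

theorem nonempty_groupOrderFive_mulEquiv {c₁ c₂ q₁ q₂ : FreeGroup (Fin 5)}
    (hc₁ : c₁ ∈ centralWords) (hc₂ : c₂ ∈ centralWords) (hq₁ : q₁ ∈ centralWords)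
    (hq₂ : q₂ ∈ centralWords) {x y : Desc Q} (h : x.a * y.b - x.b * y.a ≠ 0) (d e d' e' : ZMod p)
    (l : Fin 5 → Desc Q) (hl : l = ![x, y, rcomm y x, ⟨0, 0, 0, d, e⟩, ⟨0, 0, 0, d', e'⟩])
    (h₁ : FreeGroup.lift l c₁ = ⟨0, 0, 0, (x.a * y.b - x.b * y.a) * x.a,
      (x.a * y.b - x.b * y.a) * x.b⟩)
    (h₂ : FreeGroup.lift l c₂ = ⟨0, 0, 0, (x.a * y.b - x.b * y.a) * y.a,
      (x.a * y.b - x.b * y.a) * y.b⟩)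
    (h₃ : FreeGroup.lift l q₁ = ⟨0, 0, 0, x.a * Q 0 0 + x.b * Q 1 0, x.a * Q 0 1 + x.b * Q 1 1⟩)
    (h₄ : FreeGroup.lift l q₂ = ⟨0, 0, 0, y.a * Q 0 0 + y.b * Q 1 0, y.a * Q 0 1 + y.b * Q 1 1⟩) :
    Nonempty (GroupOrderFive p c₁ c₂ q₁ q₂ ≃* Desc Q) := by
  subst hl
  have hz : (rcomm y x).c = x.a * y.b - x.b * y.a := by rw [rcomm_c]; ring
  refine OrderFiveRelations.nonempty_mulEquiv ?_ hc₁ hc₂ hq₁ hq₂ card ?_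
    (h := ![x, y, rcomm y x, ⟨0, 0, 0, d, e⟩, ⟨0, 0, 0, d', e'⟩])
  · refine ⟨rfl, ?_, ?_, ?_, ?_, ?_, ?_, ?_, central_mem_center _ _, central_mem_center _ _⟩
    · rw [h₁, ← hz]; exact rcomm_of_eq_zero (rcomm_a _ _) (rcomm_b _ _) _
    · rw [h₂, ← hz]; exact rcomm_of_eq_zero (rcomm_a _ _) (rcomm_b _ _) _
    · rw [h₃]; exact pow_prime x
    · rw [h₄]; exact pow_prime y
    · refine (pow_prime (rcomm y x)).trans ?_
      simp only [rcomm_a, rcomm_b, zero_mul, add_zero]; rfl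
    · refine (pow_prime (⟨0, 0, 0, d, e⟩ : Desc Q)).trans ?_
      simp only [zero_mul, add_zero]; rfl
    · refine (pow_prime (⟨0, 0, 0, d', e'⟩ : Desc Q)).trans ?_
      simp only [zero_mul, add_zero]; rfl
  · rw [eq_top_iff, ← closure_pair_eq_top h, Subgroup.closure_le]
    rintro _ (rfl | rfl)
    · exact Subgroup.subset_closure ⟨0, rfl⟩
    · exact Subgroup.subset_closure ⟨1, rfl⟩

/-- The rows of A serve as new generators of `Desc Q`; the equation AQ = det(A) RA says precisely
that their p-th powers are given by R in terms of their own triple commutators. -/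
theorem nonempty_standard_mulEquiv_of_detEquiv {R : Matrix (Fin 2) (Fin 2) (ZMod p)}
    (h : DetEquiv R Q) : Nonempty (GroupOrderFive p genFour genFive (rowWord (R 0 0) (R 0 1))
      (rowWord (R 1 0) (R 1 1)) ≃* Desc Q) := by
  obtain ⟨A, hA, h⟩ := detEquiv_iff.1 h
  have e00 := congrFun (congrFun h 0) 0
  have e01 := congrFun (congrFun h 0) 1
  have e10 := congrFun (congrFun h 1) 0
  have e11 := congrFun (congrFun h 1) 1
  simp only [Matrix.mul_apply, Fin.sum_univ_two, Matrix.smul_apply, smul_eq_mul,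
    Matrix.det_fin_two] at e00 e01 e10 e11 hA
  refine nonempty_groupOrderFive_mulEquiv (x := ⟨A 0 0, A 0 1, 0, 0, 0⟩)
    (y := ⟨A 1 0, A 1 1, 0, 0, 0⟩) genFour_mem genFive_mem (rowWord_mem _ _) (rowWord_mem _ _) hA
    _ _ _ _ _ rfl FreeGroup.lift_apply_of FreeGroup.lift_apply_of ?_ ?_
  · rw [lift_rowWord, e00, e01]
    refine (zmodPow_central_mul_zmodPow_central _ _ _ _ _ _).trans ?_
    congr 1 <;> ring
  · rw [lift_rowWord, e10, e11]
    refine (zmodPow_central_mul_zmodPow_central _ _ _ _ _ _).trans ?_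
    congr 1 <;> ring

theorem nonempty_standard_mulEquiv (Q : Matrix (Fin 2) (Fin 2) (ZMod p)) :
    Nonempty (GroupOrderFive p genFour genFive (rowWord (Q 0 0) (Q 0 1))
      (rowWord (Q 1 0) (Q 1 1)) ≃* Desc Q) :=
  nonempty_standard_mulEquiv_of_detEquiv (DetEquiv.refl Q)

/-- In `MatrixGroup m` the basis of the bottom layer consists of p-th powers, and m expresses the
commutators in it; solving for the p-th powers inverts m. -/
theorem nonempty_matrixGroup_mulEquiv {m : Matrix (Fin 2) (Fin 2) (ZMod p)} (hm : m.det ≠ 0) :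
    Nonempty (MatrixGroup m ≃* Desc m⁻¹) := by
  have h := Matrix.mul_nonsing_inv m hm.isUnit
  have e00 := congrFun (congrFun h 0) 0
  have e01 := congrFun (congrFun h 0) 1
  have e10 := congrFun (congrFun h 1) 0
  have e11 := congrFun (congrFun h 1) 1
  simp only [Matrix.mul_apply, Fin.sum_univ_two] at e00 e01 e10 e11
  refine nonempty_groupOrderFive_mulEquiv (x := ⟨1, 0, 0, 0, 0⟩)
    (y := ⟨0, 1, 0, 0, 0⟩) (rowWord_mem _ _) (rowWord_mem _ _) genFour_mem genFive_mem (by simp)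
    (m⁻¹ 0 0) (m⁻¹ 0 1) (m⁻¹ 1 0) (m⁻¹ 1 1) _ rfl
    ((lift_rowWord _ _ _).trans ((zmodPow_central_mul_zmodPow_central _ _ _ _ _ _).trans ?_))
    ((lift_rowWord _ _ _).trans ((zmodPow_central_mul_zmodPow_central _ _ _ _ _ _).trans ?_))
    (FreeGroup.lift_apply_of.trans ?_) (FreeGroup.lift_apply_of.trans ?_)
  · rw [e00, e01]; simp
  · rw [e10, e11]; simp
  · simp
  · simp

/-- An isomorphism carries the expressions of x^p and y^p through triple commutators to the images
of x and y; reading coordinates yields AR = det(A) QA, where A is the induced map on the first two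
coordinates. -/
theorem nonempty_mulEquiv_iff {Q R : Matrix (Fin 2) (Fin 2) (ZMod p)} :
    Nonempty (Desc Q ≃* Desc R) ↔ DetEquiv Q R := by
  constructor
  · rintro ⟨φ⟩
    let x : Desc Q := ⟨1, 0, 0, 0, 0⟩
    let y : Desc Q := ⟨0, 1, 0, 0, 0⟩
    have hx : rcomm (rcomm y x) x = ⟨0, 0, 0, 1, 0⟩ := by
      rw [rcomm_of_eq_zero (rcomm_a _ _) (rcomm_b _ _), rcomm_c]; simp [x, y]
    have hy : rcomm (rcomm y x) y = ⟨0, 0, 0, 0, 1⟩ := by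
      rw [rcomm_of_eq_zero (rcomm_a _ _) (rcomm_b _ _), rcomm_c]; simp [x, y]
    have px : x ^ p = zmodPow (rcomm (rcomm y x) x) (Q 0 0) *
        zmodPow (rcomm (rcomm y x) y) (Q 0 1) := by
      rw [hx, hy, zmodPow_central_mul_zmodPow_central, pow_prime]; simp [x]
    have py : y ^ p = zmodPow (rcomm (rcomm y x) x) (Q 1 0) *
        zmodPow (rcomm (rcomm y x) y) (Q 1 1) := by
      rw [hx, hy, zmodPow_central_mul_zmodPow_central, pow_prime]; simp [y]
    have hr (s t u : Desc Q) : φ (rcomm (rcomm s t) u) = rcomm (rcomm (φ s) (φ t)) (φ u) := by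
      simpa using (map_rcomm (φ : Desc Q →* Desc R) (rcomm s t) u).trans
        (congrArg (rcomm · _) (map_rcomm (φ : Desc Q →* Desc R) s t))
    have px' := congrArg φ px
    have py' := congrArg φ py
    have hzp (s : Desc Q) (u : ZMod p) : φ (zmodPow s u) = zmodPow (φ s) u :=
      map_zmodPow (φ : Desc Q →* Desc R) s u
    rw [map_pow, map_mul, hzp, hzp, hr, hr, rcomm_of_eq_zero (rcomm_a _ _) (rcomm_b _ _),
      rcomm_of_eq_zero (rcomm_a _ _) (rcomm_b _ _), rcomm_c, zmodPow_central_mul_zmodPow_central,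
      pow_prime, Desc.mk.injEq] at px' py'
    obtain ⟨-, -, -, e1, e2⟩ := px'
    obtain ⟨-, -, -, e3, e4⟩ := py'
    refine detEquiv_iff.2 ⟨!![(φ x).a, (φ x).b; (φ y).a, (φ y).b], ?_, ?_⟩
    · rw [Matrix.det_fin_two_of]
      -- Were A singular, the nontrivial element [[y, x], x] would be mapped to 1.
      intro h0
      have h1 := congrArg φ hx
      rw [hr, rcomm_of_eq_zero (rcomm_a _ _) (rcomm_b _ _), rcomm_c,
        show (φ y).b * (φ x).a - (φ y).a * (φ x).b = 0 by linear_combination h0, zero_mul,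
        zero_mul] at h1
      have h2 : (1 : Desc Q) = ⟨0, 0, 0, 1, 0⟩ := φ.injective ((map_one φ).trans h1)
      have h3 := congrArg Desc.d h2
      exact zero_ne_one h3
    · ext i j
      fin_cases i <;> fin_cases j <;>
        simp [Matrix.mul_apply, Fin.sum_univ_two, Matrix.det_fin_two]
      · linear_combination e1
      · linear_combination e2
      · linear_combination e3
      · linear_combination e4
  · intro h
    obtain ⟨f⟩ := nonempty_standard_mulEquiv Q
    obtain ⟨g⟩ := nonempty_standard_mulEquiv_of_detEquiv h
    exact ⟨f.symm.trans g⟩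

end Desc

/-! ### The listed groups as model groups -/

section Labels

variable {p : ℕ} [Fact p.Prime] [hp : Fact (3 < p)]

theorem det_orbitRep_H10_ne_zero {w : (ZMod p)ˣ} (hw : ∀ x, x ∈ Subgroup.zpowers w) (k hk) :
    (orbitRep w (.H10 k hk)).det ≠ 0 := by
  rw [det_orbitRep_H10]
  intro h
  refine not_isSquare_pow_odd hw (by have := hp.out; omega) k ⟨1, ?_⟩
  linear_combination -h

/-- The list has two conventions: for singular m the columns of m give p-th powers in terms of
commutators, for invertible m its rows give commutators in terms of p-th powers. -/
theorem descData_eq {w : (ZMod p)ˣ} (hw : ∀ x, x ∈ Subgroup.zpowers w) (i : DescLabel p) :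
    (orbitRep w i).det = 0 ∧ descData w i = (genFour, genFive,
      rowWord ((orbitRep w i) 0 0) ((orbitRep w i) 1 0),
      rowWord ((orbitRep w i) 0 1) ((orbitRep w i) 1 1)) ∨
    (orbitRep w i).det ≠ 0 ∧ descData w i = (rowWord ((orbitRep w i) 0 0) ((orbitRep w i) 0 1),
      rowWord ((orbitRep w i) 1 0) ((orbitRep w i) 1 1), genFour, genFive) := by
  cases i
  case H1 | H2 | H3 | H4 =>
    left
    simp [orbitRep, descData, rowWord, zmodPow_zero, zmodPow_one]
  case H10 k hk =>
    right
    refine ⟨det_orbitRep_H10_ne_zero hw k hk, ?_⟩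
    simp [orbitRep, descData, rowWord, zmodPow_one]
  all_goals
    right
    simp [orbitRep, descData, rowWord, zmodPow_zero, zmodPow_one]

theorem nonempty_descGroup_mulEquiv {w : (ZMod p)ˣ} (hw : ∀ x, x ∈ Subgroup.zpowers w)
    (i : DescLabel p) : Nonempty (DescGroup w i ≃* Desc (matDual (orbitRep w i))) := by
  unfold DescGroup
  obtain ⟨h, hd⟩ | ⟨h, hd⟩ := descData_eq hw i
  · rw [matDual_of_det_eq_zero h, hd]
    exact Desc.nonempty_standard_mulEquiv (orbitRep w i).transpose
  · rw [matDual_of_det_ne_zero h, hd]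
    exact Desc.nonempty_matrixGroup_mulEquiv h

theorem eq_of_descGroup_mulEquiv {w : (ZMod p)ˣ} (hw : ∀ x, x ∈ Subgroup.zpowers w)
    {i j : DescLabel p} (h : Nonempty (DescGroup w i ≃* DescGroup w j)) : i = j := by
  obtain ⟨e⟩ := h
  obtain ⟨f⟩ := nonempty_descGroup_mulEquiv hw i
  obtain ⟨g⟩ := nonempty_descGroup_mulEquiv hw j
  have := (Desc.nonempty_mulEquiv_iff.1 ⟨f.symm.trans (e.trans g)⟩).matDual
  rw [matDual_matDual, matDual_matDual] at this
  exact eq_of_detEquiv_orbitRep hw hp.out this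

theorem exists_descGroup_mulEquiv {w : (ZMod p)ˣ} (hw : ∀ x, x ∈ Subgroup.zpowers w)
    (Q : Matrix (Fin 2) (Fin 2) (ZMod p)) :
    ∃ i : DescLabel p, Nonempty (Desc Q ≃* DescGroup w i) := by
  obtain ⟨i, hi⟩ := exists_orbitRep hw (by have := hp.out; omega) (matDual Q)
  have := hi.symm.matDual
  rw [matDual_matDual] at this
  obtain ⟨e⟩ := Desc.nonempty_mulEquiv_iff.2 this
  obtain ⟨f⟩ := nonempty_descGroup_mulEquiv hw i
  exact ⟨i, ⟨e.trans f.symm⟩⟩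

theorem nonempty_matrixGroup_mulEquiv_descGroup_iff {w : (ZMod p)ˣ}
    (hw : ∀ x, x ∈ Subgroup.zpowers w) {m : Matrix (Fin 2) (Fin 2) (ZMod p)} (hm : m.det ≠ 0)
    (i : DescLabel p) :
    Nonempty (MatrixGroup m ≃* DescGroup w i) ↔ DetEquiv (orbitRep w i) m := by
  obtain ⟨f⟩ := Desc.nonempty_matrixGroup_mulEquiv hm
  obtain ⟨g⟩ := nonempty_descGroup_mulEquiv hw i
  rw [← matDual_of_det_ne_zero hm] at f
  constructor
  · rintro ⟨e⟩
    have := (Desc.nonempty_mulEquiv_iff.1 ⟨f.symm.trans (e.trans g)⟩).matDual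
    rw [matDual_matDual, matDual_matDual] at this
    exact this.symm
  · intro h
    obtain ⟨e⟩ := Desc.nonempty_mulEquiv_iff.2 h.symm.matDual
    exact ⟨f.trans (e.trans g.symm)⟩

end Labels

/-! ### The lower exponent-p central series -/

section CentralSeries

theorem map_pCentralSeries {G H : Type*} [Group G] [Group H] (p : ℕ) (f : G →* H)
    (hf : Function.Surjective f) (i : ℕ) :
    (pCentralSeries p G i).map f = pCentralSeries p H i := by
  induction i with
  | zero =>
    simp only [pCentralSeries]
    rw [← MonoidHom.range_eq_map, MonoidHom.range_eq_top.2 hf]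
  | succ i ih =>
    simp only [pCentralSeries, MonoidHom.map_closure, ← ih]
    congr 1
    ext y
    constructor
    · rintro ⟨_, ⟨h, hh, k, hk, g, rfl⟩, rfl⟩
      exact ⟨f h, ⟨h, hh, rfl⟩, f k, ⟨k, hk, rfl⟩, f g, by rw [map_mul, map_rcomm, map_pow]⟩
    · rintro ⟨_, ⟨h, hh, rfl⟩, _, ⟨k, hk, rfl⟩, g, rfl⟩
      obtain ⟨g, rfl⟩ := hf g
      exact ⟨_, ⟨h, hh, k, hk, g, rfl⟩, by rw [map_mul, map_rcomm, map_pow]⟩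

theorem rcomm_mem_pCentralSeries {p : ℕ} {G : Type*} [Group G] {i : ℕ} {h : G}
    (hh : h ∈ pCentralSeries p G i) (g : G) : rcomm h g ∈ pCentralSeries p G (i + 1) :=
  Subgroup.subset_closure ⟨h, hh, 1, one_mem _, g, by simp⟩

theorem pow_mem_pCentralSeries {p : ℕ} {G : Type*} [Group G] {i : ℕ} {k : G}
    (hk : k ∈ pCentralSeries p G i) : k ^ p ∈ pCentralSeries p G (i + 1) :=
  Subgroup.subset_closure ⟨1, one_mem _, k, hk, 1, by simp [rcomm]⟩

theorem pCentralSeries_succ_le {p : ℕ} {G : Type*} [Group G] {i : ℕ} {K : Subgroup G}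
    (hcomm : ∀ h ∈ pCentralSeries p G i, ∀ g, rcomm h g ∈ K)
    (hpow : ∀ k ∈ pCentralSeries p G i, k ^ p ∈ K) : pCentralSeries p G (i + 1) ≤ K := by
  refine (Subgroup.closure_le _).2 ?_
  rintro _ ⟨h, hh, k, hk, g, rfl⟩
  exact mul_mem (hcomm h hh g) (hpow k hk)

theorem pCentralSeries_antitone {p : ℕ} {G : Type*} [Group G] :
    Antitone (pCentralSeries p G) := by
  refine antitone_nat_of_succ_le fun i => pCentralSeries_succ_le (fun h hh g => ?_)
    fun k hk => pow_mem hk p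
  have h1 := (pCentralSeries_normal p G i).conj_mem h hh g⁻¹
  rw [inv_inv] at h1
  have := mul_mem (inv_mem hh) h1
  simpa [rcomm, mul_assoc] using this

theorem hasPClass_succ {p : ℕ} {G : Type*} [Group G] {c : ℕ} (h : pCentralSeries p G (c + 1) = ⊥)
    (h' : pCentralSeries p G c ≠ ⊥) : HasPClass p G (c + 1) := by
  refine ⟨h, fun i hi => ?_⟩
  by_contra! hlt
  apply h'
  rw [eq_bot_iff, ← show pCentralSeries p G i = ⊥ from hi]
  exact pCentralSeries_antitone (by omega)

theorem HasPClass.congr {p : ℕ} {G H : Type*} [Group G] [Group H] {c : ℕ} (h : HasPClass p G c)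
    (e : G ≃* H) : HasPClass p H c := by
  have (i : ℕ) : pCentralSeries p H i = ⊥ ↔ pCentralSeries p G i = ⊥ := by
    rw [← map_pCentralSeries p (e : G →* H) e.surjective, Subgroup.map_eq_bot_iff_of_injective]
    exact e.injective
  simpa only [HasPClass, this] using h

theorem IsImmediateDescendant.congr {p : ℕ} {G H K : Type*} [Group G] [Group H] [Group K]
    (h : IsImmediateDescendant p G H) (e : H ≃* K) : IsImmediateDescendant p G K := by
  have := h.finite_left
  have := h.finite_right
  have : Finite K := Finite.of_equiv _ e.toEquiv
  obtain ⟨c, hc, hc', ⟨f⟩⟩ := h.exists_class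
  exact
    { isPGroup_left := h.isPGroup_left
      isPGroup_right := h.isPGroup_right.of_equiv e
      rank_eq := (Group.rank_congr e).symm.trans h.rank_eq
      exists_class := ⟨c, hc, hc'.congr e, ⟨(QuotientGroup.congr _ _ e
        (map_pCentralSeries p (e : H →* K) e.surjective c)).symm.trans f⟩⟩ }

theorem rank_eq_two {G : Type*} [Group G] [Group.FG G] {x y : G}
    (htop : Subgroup.closure {x, y} = ⊤) (h : ¬ Commute x y) : Group.rank G = 2 := by
  classical
  apply le_antisymm
  · have : Subgroup.closure (({x, y} : Finset G) : Set G) = ⊤ := by simpa using htop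
    exact (Group.rank_le this).trans Finset.card_le_two
  · by_contra! hlt
    obtain ⟨S, hS, hS'⟩ := Group.rank_spec G
    have hcard : S.card ≤ 1 := by omega
    obtain ⟨z, hz⟩ := Finset.card_le_one_iff_subset_singleton.1 hcard
    have hcen (g : G) : g ∈ Subgroup.zpowers z := by
      rw [Subgroup.zpowers_eq_closure]
      exact Subgroup.closure_mono (by exact_mod_cast hz) (hS' ▸ Subgroup.mem_top g)
    obtain ⟨i, rfl⟩ := hcen x
    obtain ⟨j, rfl⟩ := hcen y
    exact h (Commute.zpow_zpow (Commute.refl z) i j)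

end CentralSeries

/-! ### The central series of the model and its Heisenberg quotient -/

namespace Desc

variable {p : ℕ} [Fact p.Prime] {Q : Matrix (Fin 2) (Fin 2) (ZMod p)} [hp : Fact (3 < p)]

/-- The first generator. -/
def genOne (Q : Matrix (Fin 2) (Fin 2) (ZMod p)) : Desc Q := ⟨1, 0, 0, 0, 0⟩

/-- The second generator. -/
def genTwo (Q : Matrix (Fin 2) (Fin 2) (ZMod p)) : Desc Q := ⟨0, 1, 0, 0, 0⟩

/-- The commutator of the generators. -/
def genThree (Q : Matrix (Fin 2) (Fin 2) (ZMod p)) : Desc Q := rcomm (genTwo Q) (genOne Q)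

theorem genThree_a : (genThree Q).a = 0 := rcomm_a _ _

theorem genThree_b : (genThree Q).b = 0 := rcomm_b _ _

theorem genThree_c : (genThree Q).c = 1 := by
  rw [genThree, rcomm_c]; simp [genOne, genTwo]

theorem closure_gens : Subgroup.closure {genOne Q, genTwo Q} = ⊤ :=
  closure_pair_eq_top (by simp [genOne, genTwo])

/-- Elements whose first three coordinates vanish. -/
def bottom (Q : Matrix (Fin 2) (Fin 2) (ZMod p)) : Subgroup (Desc Q) where
  carrier := {x | x.a = 0 ∧ x.b = 0 ∧ x.c = 0}
  mul_mem' := by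
    rintro x y ⟨h1, h2, h3⟩ ⟨h4, h5, h6⟩
    simp [h1, h2, h3, h4, h5, h6]
  one_mem' := by simp
  inv_mem' := by
    rintro x ⟨h1, h2, h3⟩
    simp [h1, h2, h3]

/-- Elements whose first two coordinates vanish. -/
def middle (Q : Matrix (Fin 2) (Fin 2) (ZMod p)) : Subgroup (Desc Q) where
  carrier := {x | x.a = 0 ∧ x.b = 0}
  mul_mem' := by
    rintro x y ⟨h1, h2⟩ ⟨h4, h5⟩
    simp [h1, h2, h4, h5]
  one_mem' := by simp
  inv_mem' := by
    rintro x ⟨h1, h2⟩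
    simp [h1, h2]

theorem pCentralSeries_one_le : pCentralSeries p (Desc Q) 1 ≤ middle Q :=
  pCentralSeries_succ_le (fun _ _ _ => ⟨rcomm_a _ _, rcomm_b _ _⟩) fun k _ => by
    rw [pow_prime]; exact ⟨rfl, rfl⟩

theorem genThree_mem : genThree Q ∈ pCentralSeries p (Desc Q) 1 :=
  rcomm_mem_pCentralSeries (Subgroup.mem_top _) _

theorem pCentralSeries_two : pCentralSeries p (Desc Q) 2 = bottom Q := by
  apply le_antisymm
  · refine pCentralSeries_succ_le (fun h hh g => ?_) fun k _ => ?_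
    · obtain ⟨ha, hb⟩ := pCentralSeries_one_le hh
      rw [rcomm_of_eq_zero ha hb]; exact ⟨rfl, rfl, rfl⟩
    · rw [pow_prime]; exact ⟨rfl, rfl, rfl⟩
  · rintro ⟨a, b, c, d, e⟩ ⟨rfl, rfl, rfl⟩
    -- Commutation with the third generator moves the first two coordinates into the last two, so
    -- every bottom element is a single commutator.
    have := rcomm_mem_pCentralSeries (genThree_mem (Q := Q)) ⟨d, e, 0, 0, 0⟩
    rw [rcomm_of_eq_zero genThree_a genThree_b, genThree_c] at this
    simpa using this

theorem pCentralSeries_three : pCentralSeries p (Desc Q) 3 = ⊥ := by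
  rw [eq_bot_iff]
  refine pCentralSeries_succ_le (fun h hh g => ?_) fun k hk => ?_
  · rw [pCentralSeries_two] at hh
    obtain ⟨ha, hb, hc⟩ := hh
    rw [rcomm_of_eq_zero ha hb, hc, Subgroup.mem_bot]
    ext <;> simp
  · rw [pCentralSeries_two] at hk
    obtain ⟨ha, hb, hc⟩ := hk
    rw [pow_prime, ha, hb, Subgroup.mem_bot]
    ext <;> simp

theorem genThree_notMem : genThree Q ∉ pCentralSeries p (Desc Q) 2 := by
  rw [pCentralSeries_two]
  rintro ⟨-, -, h⟩
  rw [genThree_c] at h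
  exact one_ne_zero h

theorem hasPClass : HasPClass p (Desc Q) 3 := by
  refine hasPClass_succ pCentralSeries_three fun h => ?_
  rw [pCentralSeries_two] at h
  have : (⟨0, 0, 0, 1, 0⟩ : Desc Q) ∈ bottom Q := ⟨rfl, rfl, rfl⟩
  rw [h, Subgroup.mem_bot] at this
  exact one_ne_zero (congrArg Desc.d this)

/-- The last two coordinates. -/
def bottomEquiv (Q : Matrix (Fin 2) (Fin 2) (ZMod p)) : bottom Q ≃ ZMod p × ZMod p where
  toFun x := (x.1.d, x.1.e)
  invFun x := ⟨⟨0, 0, 0, x.1, x.2⟩, rfl, rfl, rfl⟩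
  left_inv := by
    rintro ⟨x, h1, h2, h3⟩
    exact Subtype.ext (Desc.ext h1.symm h2.symm h3.symm rfl rfl)
  right_inv _ := rfl

theorem card_quotient : Nat.card (Desc Q ⧸ pCentralSeries p (Desc Q) 2) = p ^ 3 := by
  have h := (pCentralSeries p (Desc Q) 2).card_eq_card_quotient_mul_card_subgroup
  rw [card, pCentralSeries_two, Nat.card_congr (bottomEquiv Q)] at h
  rw [pCentralSeries_two]
  have hp0 : 0 < p := NeZero.pos p
  simp only [Nat.card_prod, Nat.card_zmod] at h
  refine Nat.eq_of_mul_eq_mul_right (Nat.mul_pos hp0 hp0) ?_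
  rw [← h]; ring

theorem groupD_relations : ∀ r ∈ pcRelators p ![1, 1, 1]
    ![![1, 1, 1], ![FreeGroup.of (2 : Fin 3), 1, 1], ![1, 1, 1]],
    FreeGroup.lift (fun i => QuotientGroup.mk' (pCentralSeries p (Desc Q) 2)
      (![genOne Q, genTwo Q, genThree Q] i)) r = 1 := by
  have hmk {x : Desc Q} (hx : x.a = 0 ∧ x.b = 0 ∧ x.c = 0) :
      QuotientGroup.mk' (pCentralSeries p (Desc Q) 2) x = 1 :=
    (QuotientGroup.eq_one_iff x).2 (by rw [pCentralSeries_two]; exact hx)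
  apply lift_pcRelators
  · intro i
    rw [← map_pow, hmk (by rw [pow_prime]; exact ⟨rfl, rfl, rfl⟩)]
    fin_cases i <;> exact (map_one _).symm
  · have h3 (x : Desc Q) : rcomm (QuotientGroup.mk' (pCentralSeries p (Desc Q) 2) (genThree Q))
        (QuotientGroup.mk' (pCentralSeries p (Desc Q) 2) x) = 1 := by
      rw [← map_rcomm, rcomm_of_eq_zero genThree_a genThree_b, hmk ⟨rfl, rfl, rfl⟩]
    intro i j hij
    fin_cases j <;> fin_cases i <;> first
      | exact absurd hij (by decide)
      | exact (map_rcomm (QuotientGroup.mk' (pCentralSeries p (Desc Q) 2)) (genTwo Q)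
          (genOne Q)).symm.trans (FreeGroup.lift_apply_of).symm
      | exact (h3 _).trans (map_one _).symm

theorem nonempty_quotient_mulEquiv (Q : Matrix (Fin 2) (Fin 2) (ZMod p)) :
    Nonempty (Desc Q ⧸ pCentralSeries p (Desc Q) 2 ≃* GroupD p) := by
  have hsurj : Function.Surjective (PresentedGroup.toGroup (groupD_relations (Q := Q))) := by
    rw [← MonoidHom.range_eq_top, eq_top_iff, ← closure_image_mk_eq_top _
      (closure_gens (Q := Q)), Subgroup.closure_le]
    rintro _ ⟨x, rfl | rfl, rfl⟩
    · exact ⟨PresentedGroup.of 0, PresentedGroup.toGroup.of _⟩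
    · exact ⟨PresentedGroup.of 1, PresentedGroup.toGroup.of _⟩
  obtain ⟨hfin, hcard⟩ := card_groupD_le (p := p)
  exact ⟨(MulEquiv.ofBijective _ (hsurj.bijective_of_nat_card_le
    (hcard.trans_eq (card_quotient (Q := Q)).symm))).symm⟩

/-- This makes D_p computable: statements about the presented group are checked on coordinates of
`Desc Q`. -/
theorem exists_surjective_groupD (Q : Matrix (Fin 2) (Fin 2) (ZMod p)) :
    ∃ f : Desc Q →* GroupD p, Function.Surjective f ∧
      ∀ x, f x = 1 ↔ x.a = 0 ∧ x.b = 0 ∧ x.c = 0 := by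
  obtain ⟨e⟩ := nonempty_quotient_mulEquiv Q
  refine ⟨e.toMonoidHom.comp (QuotientGroup.mk' _),
    e.surjective.comp (QuotientGroup.mk'_surjective _), fun x => ?_⟩
  rw [MonoidHom.comp_apply, MulEquiv.coe_toMonoidHom, e.map_eq_one_iff, QuotientGroup.mk'_apply,
    QuotientGroup.eq_one_iff, pCentralSeries_two]
  rfl

end Desc

/-! ### The model groups are immediate descendants of D_p -/

section GroupD

variable {p : ℕ} [Fact p.Prime] [hp : Fact (3 < p)]

theorem card_groupD : Nat.card (GroupD p) = p ^ 3 := by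
  obtain ⟨e⟩ := Desc.nonempty_quotient_mulEquiv (0 : Matrix (Fin 2) (Fin 2) (ZMod p))
  rw [← Nat.card_congr e.toEquiv, Desc.card_quotient]

theorem hasPClass_groupD : HasPClass p (GroupD p) 2 := by
  obtain ⟨f, hf, hker⟩ := Desc.exists_surjective_groupD (0 : Matrix (Fin 2) (Fin 2) (ZMod p))
  apply hasPClass_succ
  · rw [← map_pCentralSeries p f hf, eq_bot_iff, Subgroup.map_le_iff_le_comap,
      Desc.pCentralSeries_two]
    intro x hx
    exact (hker x).2 hx
  · rw [← map_pCentralSeries p f hf]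
    intro h
    have := Subgroup.mem_map_of_mem f (Desc.genThree_mem (Q := (0 : Matrix _ _ (ZMod p))))
    rw [h, Subgroup.mem_bot, hker] at this
    exact Desc.genThree_notMem (Q := (0 : Matrix _ _ (ZMod p))) (by rw [Desc.pCentralSeries_two]; exact this)

theorem Desc.isImmediateDescendant (Q : Matrix (Fin 2) (Fin 2) (ZMod p)) :
    IsImmediateDescendant p (GroupD p) (Desc Q) := by
  have := (card_groupD_le (p := p)).1
  obtain ⟨f, hf, hker⟩ := Desc.exists_surjective_groupD Q
  have h3 : f (Desc.genThree Q) ≠ 1 := by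
    rw [Ne, hker, Desc.genThree_c]; simp
  have h1 : Group.rank (Desc Q) = 2 := rank_eq_two Desc.closure_gens fun h => by
    apply h3
    rw [Desc.genThree, rcomm_eq_one_iff.2 h.symm, map_one]
  have h2 : Group.rank (GroupD p) = 2 := by
    refine rank_eq_two (x := f (Desc.genOne Q)) (y := f (Desc.genTwo Q)) ?_ fun h => ?_
    · rw [← Set.image_pair, ← MonoidHom.map_closure, Desc.closure_gens, ← MonoidHom.range_eq_map,
        MonoidHom.range_eq_top.2 hf]
    · apply h3
      rw [Desc.genThree, map_rcomm, rcomm_eq_one_iff.2 h.symm]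
  exact
    { isPGroup_left := IsPGroup.of_card card_groupD
      isPGroup_right := IsPGroup.of_card Desc.card
      rank_eq := h1.trans h2.symm
      exists_class := ⟨2, hasPClass_groupD, Desc.hasPClass, Desc.nonempty_quotient_mulEquiv Q⟩ }

end GroupD

/-! ### Every descendant of order p^5 is a model group -/

section Completeness

theorem pow_mul_eq_of_central {G : Type*} [Group G] {y z : G}
    (hu : rcomm z y ∈ Subgroup.center G) (n : ℕ) : z ^ n * y = y * z ^ n * rcomm z y ^ n := by
  have hc (g : G) (k : ℕ) : Commute g (rcomm z y ^ k) :=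
    Commute.pow_right (Subgroup.mem_center_iff.1 hu g) k
  induction n with
  | zero => simp
  | succ n ih =>
    calc z ^ (n + 1) * y = z * (z ^ n * y) := by rw [pow_succ', mul_assoc]
      _ = (z * y) * (z ^ n * rcomm z y ^ n) := by rw [ih]; simp only [mul_assoc]
      _ = y * z * (rcomm z y * z ^ n) * rcomm z y ^ n := by
        rw [mul_eq_mul_mul_rcomm z y]; simp only [mul_assoc]
      _ = y * z ^ (n + 1) * rcomm z y ^ (n + 1) := by
        rw [(Subgroup.mem_center_iff.1 hu (z ^ n)).symm, pow_succ' z, pow_succ' (rcomm z y)]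
        simp only [mul_assoc]

theorem mul_pow_eq_of_central {G : Type*} [Group G] {y z : G}
    (hu : rcomm z y ∈ Subgroup.center G) (n : ℕ) :
    (y * z) ^ n = y ^ n * z ^ n * rcomm z y ^ n.choose 2 := by
  have hc (g : G) (k : ℕ) : Commute g (rcomm z y ^ k) :=
    Commute.pow_right (Subgroup.mem_center_iff.1 hu g) k
  induction n with
  | zero => simp
  | succ n ih =>
    calc (y * z) ^ (n + 1) = y ^ n * (z ^ n * (rcomm z y ^ n.choose 2 * y)) * z := by
          rw [pow_succ, ih]; simp only [mul_assoc]
      _ = y ^ n * (z ^ n * y) * (rcomm z y ^ n.choose 2 * z) := by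
        rw [← (hc y _).eq]; simp only [mul_assoc]
      _ = y ^ n * y * z ^ n * (rcomm z y ^ n * z) * rcomm z y ^ n.choose 2 := by
        rw [← (hc z _).eq, pow_mul_eq_of_central hu]
        simp only [mul_assoc]
      _ = y ^ (n + 1) * z ^ (n + 1) * rcomm z y ^ (n + 1).choose 2 := by
        rw [← (hc z _).eq, Nat.choose_succ_succ' n 1, Nat.choose_one_right, pow_add (rcomm z y),
          pow_succ y, pow_succ z]
        simp only [mul_assoc]

/-- Put z = [y, x]. As y^p is central, the conjugate yz of y has the same p-th power; expanding
(yz)^p gives y^p z^p [z, y]^(p choose 2), whose last factor is trivial because p divides the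
binomial coefficient. -/
theorem rcomm_pow_eq_one {p : ℕ} (hp : p.Prime) (hp2 : p ≠ 2) {G : Type*} [Group G] {x y : G}
    (hy : y ^ p ∈ Subgroup.center G) (hu : rcomm (rcomm y x) y ∈ Subgroup.center G)
    (hup : rcomm (rcomm y x) y ^ p = 1) : rcomm y x ^ p = 1 := by
  have h1 : x⁻¹ * y * x = y * rcomm y x := by simp [rcomm, mul_assoc]
  have h2 : (x⁻¹ * y * x) ^ p = y ^ p := by
    have := conj_pow (i := p) (a := x⁻¹) (b := y)
    rw [inv_inv] at this
    rw [this, mul_assoc, ← Subgroup.mem_center_iff.1 hy x, inv_mul_cancel_left]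
  obtain ⟨k, hk⟩ := hp.dvd_choose_self (k := 2) (by norm_num) (lt_of_le_of_ne hp.two_le hp2.symm)
  rw [h1, mul_pow_eq_of_central hu, hk, pow_mul, hup, one_pow, mul_one] at h2
  exact mul_eq_left.1 h2

variable {p : ℕ} [Fact p.Prime] [hp : Fact (3 < p)]

theorem exists_desc_mulEquiv {H : Type*} [Group H] {Z : Subgroup H} {h₁ h₂ : H}
    (hH : Nat.card H = p ^ 5) (hcen : Z ≤ Subgroup.center H) (hexp : ∀ z ∈ Z, z ^ p = 1)
    (hgen : ∀ g, ∃ k ∈ Subgroup.closure {h₁, h₂}, ∃ z ∈ Z, g = k * z)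
    (hx : h₁ ^ p ∈ Z) (hy : h₂ ^ p ∈ Z) (hzx : rcomm (rcomm h₂ h₁) h₁ ∈ Z)
    (hzy : rcomm (rcomm h₂ h₁) h₂ ∈ Z)
    (hγ : ∀ k ∈ pCentralSeries p H 1, ∃ i : ℕ, ∃ z ∈ Z, k = rcomm h₂ h₁ ^ i * z)
    (hZ : Z = pCentralSeries p H 2) : ∃ Q : Matrix (Fin 2) (Fin 2) (ZMod p), Nonempty (H ≃* Desc Q) := by
  set h₃ := rcomm h₂ h₁ with hh₃
  set W := Subgroup.closure {rcomm h₃ h₁, rcomm h₃ h₂} with hW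
  have hWZ : W ≤ Z := (Subgroup.closure_le _).2 (by rintro _ (rfl | rfl) <;> assumption)
  have hnormal : W.Normal := normal_of_le_center (hWZ.trans hcen)
  have h3p : h₃ ^ p = 1 := rcomm_pow_eq_one Fact.out (by have := hp.out; omega) (hcen hy)
    (hcen hzy) (hexp _ hzy)
  have hker {g : H} (hg : g ∈ W) : QuotientGroup.mk' W g = 1 := (QuotientGroup.eq_one_iff g).2 hg
  have h3cen (g : H) : rcomm h₃ g ∈ W := by
    rw [← QuotientGroup.eq_one_iff, ← QuotientGroup.mk'_apply, map_rcomm, rcomm_eq_one_iff]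
    have hle : Subgroup.closure {h₁, h₂} ≤
        (Subgroup.centralizer {QuotientGroup.mk' W h₃}).comap (QuotientGroup.mk' W) := by
      rw [Subgroup.closure_le]
      rintro _ (rfl | rfl)
      · rw [SetLike.mem_coe, Subgroup.mem_comap, Subgroup.mem_centralizer_singleton_iff]
        exact (rcomm_eq_one_iff.1 ((map_rcomm _ _ _).symm.trans
          (hker (Subgroup.subset_closure (.inl rfl))))).symm.eq
      · rw [SetLike.mem_coe, Subgroup.mem_comap, Subgroup.mem_centralizer_singleton_iff]
        exact (rcomm_eq_one_iff.1 ((map_rcomm _ _ _).symm.trans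
          (hker (Subgroup.subset_closure (.inr rfl))))).symm.eq
    obtain ⟨k, hk, z, hz, rfl⟩ := hgen g
    rw [map_mul]
    refine Commute.mul_right (Subgroup.mem_centralizer_singleton_iff.1 (hle hk)).symm ?_
    exact Commute.map (Subgroup.mem_center_iff.1 (hcen hz) h₃) (QuotientGroup.mk' W)
  -- γ₂ is generated by commutators and p-th powers from γ₁ = ⟨h₃⟩Z. Modulo W the element h₃ is
  -- central, and the p-th powers vanish since h₃^p = 1 and Z is central of exponent p.
  have hZW : Z ≤ W := by
    rw [hZ]
    refine pCentralSeries_succ_le (fun h hh g => ?_) fun k hk => ?_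
    · obtain ⟨i, z, hz, rfl⟩ := hγ h hh
      rw [← QuotientGroup.eq_one_iff, ← QuotientGroup.mk'_apply, map_rcomm, rcomm_eq_one_iff, map_mul,
        map_pow]
      refine Commute.mul_left (Commute.pow_left ?_ i) ?_
      · rw [← rcomm_eq_one_iff, ← map_rcomm]
        exact hker (h3cen g)
      · exact Commute.map (Subgroup.mem_center_iff.1 (hcen hz) g).symm (QuotientGroup.mk' W)
    · obtain ⟨i, z, hz, rfl⟩ := hγ k hk
      rw [Commute.mul_pow (Subgroup.mem_center_iff.1 (hcen hz) _), hexp z hz, ← pow_mul, mul_comm,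
        pow_mul, h3p, one_pow, one_mul]
      exact one_mem _
  have hrow {z : H} (hz : z ∈ Z) :=
    exists_zmodPow_mul_zmodPow (p := p) (Subgroup.mem_center_iff.1 (hcen hzy) (rcomm h₃ h₁))
      (hexp _ hzx) (hexp _ hzy) (hZW hz)
  obtain ⟨a, b, hab⟩ := hrow hx
  obtain ⟨c, d, hcd⟩ := hrow hy
  refine ⟨!![a, b; c, d], ?_⟩
  obtain ⟨e⟩ := Desc.nonempty_standard_mulEquiv !![a, b; c, d]
  let h : Fin 5 → H := ![h₁, h₂, h₃, rcomm h₃ h₁, rcomm h₃ h₂]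
  have hrel : OrderFiveRelations p genFour genFive (rowWord a b) (rowWord c d) h :=
    { comm_one_zero := rfl
      comm_two_zero := FreeGroup.lift_apply_of.symm
      comm_two_one := FreeGroup.lift_apply_of.symm
      pow_zero := by rw [lift_rowWord]; exact hab
      pow_one := by rw [lift_rowWord]; exact hcd
      pow_two := h3p
      pow_three := hexp _ hzx
      pow_four := hexp _ hzy
      center_three := hcen hzx
      center_four := hcen hzy }
  have htop : Subgroup.closure (Set.range h) = ⊤ := by
    rw [eq_top_iff]
    rintro g -
    have hW' : W ≤ Subgroup.closure (Set.range h) := Subgroup.closure_mono (by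
      rintro _ (rfl | rfl)
      exacts [⟨3, rfl⟩, ⟨4, rfl⟩])
    have hK : Subgroup.closure {h₁, h₂} ≤ Subgroup.closure (Set.range h) := Subgroup.closure_mono (by
      rintro _ (rfl | rfl)
      exacts [⟨0, rfl⟩, ⟨1, rfl⟩])
    obtain ⟨k, hk, z, hz, rfl⟩ := hgen g
    exact mul_mem (hK hk) (hW' (hZW hz))
  obtain ⟨f⟩ := hrel.nonempty_mulEquiv genFour_mem genFive_mem (rowWord_mem _ _) (rowWord_mem _ _)
    hH htop
  exact ⟨f.symm.trans e⟩

theorem IsImmediateDescendant.exists_desc_mulEquiv {H : Type*} [Group H]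
    (h : IsImmediateDescendant p (GroupD p) H) (hH : Nat.card H = p ^ 5) :
    ∃ Q : Matrix (Fin 2) (Fin 2) (ZMod p), Nonempty (H ≃* Desc Q) := by
  obtain ⟨c, hc, hc', ⟨e⟩⟩ := h.exists_class
  obtain rfl : c = 2 := hc.unique hasPClass_groupD
  obtain ⟨f, hf, hker⟩ := Desc.exists_surjective_groupD (0 : Matrix (Fin 2) (Fin 2) (ZMod p))
  let π : H →* GroupD p := e.toMonoidHom.comp (QuotientGroup.mk' (pCentralSeries p H 2))
  have hπ : Function.Surjective π := e.surjective.comp (QuotientGroup.mk'_surjective _)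
  have hπker (g : H) : π g = 1 ↔ g ∈ pCentralSeries p H 2 := by
    rw [MonoidHom.comp_apply, MulEquiv.coe_toMonoidHom, e.map_eq_one_iff, QuotientGroup.mk'_apply,
      QuotientGroup.eq_one_iff]
  have hπeq {g k : H} (hgk : π g = π k) : ∃ z ∈ pCentralSeries p H 2, g = k * z :=
    ⟨k⁻¹ * g, by rw [← hπker, map_mul, map_inv, hgk, inv_mul_cancel], by group⟩
  have hγ3 : pCentralSeries p H 3 = ⊥ := hc'.1
  have hone {x : Desc (0 : Matrix (Fin 2) (Fin 2) (ZMod p))} (ha : x.a = 0) (hb : x.b = 0)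
      (hc : x.c = 0) : f x = 1 := (hker x).2 ⟨ha, hb, hc⟩
  -- The generators are lifted from D_p, seen as a quotient of `Desc 0`; membership in γ₂(H) can
  -- then be tested in the coordinates of `Desc 0`.
  obtain ⟨h₁, hh₁⟩ := hπ (f (Desc.genOne 0))
  obtain ⟨h₂, hh₂⟩ := hπ (f (Desc.genTwo 0))
  have hh₃ : π (rcomm h₂ h₁) = f (Desc.genThree 0) := by
    rw [map_rcomm, hh₁, hh₂, ← map_rcomm, Desc.genThree]
  refine _root_.exists_desc_mulEquiv (Z := pCentralSeries p H 2) (h₁ := h₁) (h₂ := h₂) hH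
    (fun z hz => ?_) (fun z hz => ?_) (fun g => ?_) ?_ ?_ ?_ ?_ (fun k hk => ?_) rfl
  · rw [Subgroup.mem_center_iff]
    intro g
    have := rcomm_mem_pCentralSeries hz g
    rw [hγ3, Subgroup.mem_bot, rcomm_eq_one_iff] at this
    exact this.symm
  · have := pow_mem_pCentralSeries hz
    rwa [hγ3, Subgroup.mem_bot] at this
  · have htop : (Subgroup.closure {h₁, h₂}).map π = ⊤ := by
      rw [MonoidHom.map_closure, Set.image_pair, hh₁, hh₂, ← Set.image_pair, ← MonoidHom.map_closure,
        Desc.closure_gens, ← MonoidHom.range_eq_map, MonoidHom.range_eq_top.2 hf]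
    obtain ⟨k, hk, hkg⟩ : π g ∈ (Subgroup.closure {h₁, h₂}).map π := htop ▸ Subgroup.mem_top _
    exact ⟨k, hk, hπeq hkg.symm⟩
  · rw [← hπker, map_pow, hh₁, ← map_pow, Desc.pow_prime]
    exact hone rfl rfl rfl
  · rw [← hπker, map_pow, hh₂, ← map_pow, Desc.pow_prime]
    exact hone rfl rfl rfl
  · rw [← hπker, map_rcomm, hh₃, hh₁, ← map_rcomm,
      Desc.rcomm_of_eq_zero Desc.genThree_a Desc.genThree_b]
    exact hone rfl rfl rfl
  · rw [← hπker, map_rcomm, hh₃, hh₂, ← map_rcomm,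
      Desc.rcomm_of_eq_zero Desc.genThree_a Desc.genThree_b]
    exact hone rfl rfl rfl
  · have h1 := Subgroup.mem_map_of_mem π hk
    rw [map_pCentralSeries p π hπ, ← map_pCentralSeries p f hf] at h1
    obtain ⟨t, ht, htk⟩ := h1
    obtain ⟨ha, hb⟩ := Desc.pCentralSeries_one_le ht
    -- The preimage t has its first two coordinates zero, so modulo the bottom layer it is the power
    -- of the third generator given by its third coordinate.
    refine ⟨t.c.val, hπeq ?_⟩
    rw [map_pow, hh₃, ← htk, ← inv_mul_eq_one, ← map_pow, ← map_inv, ← map_mul, Desc.pow_eq]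
    apply hone
    · simp [ha, Desc.genThree_a]
    · simp [hb, Desc.genThree_b]
    · simp [ha, hb, Desc.genThree_a, Desc.genThree_b, Desc.genThree_c]

end Completeness

/-! ### Counting isomorphism classes -/

section Count

variable {p : ℕ} [Fact p.Prime] [hp : Fact (3 < p)]

theorem isImmediateDescendant_descGroup {w : (ZMod p)ˣ} (hw : ∀ x, x ∈ Subgroup.zpowers w)
    (i : DescLabel p) : IsImmediateDescendant p (GroupD p) (DescGroup w i) ∧
      Nat.card (DescGroup w i) = p ^ 5 := by
  obtain ⟨e⟩ := nonempty_descGroup_mulEquiv hw i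
  exact ⟨(Desc.isImmediateDescendant _).congr e.symm, (Nat.card_congr e.toEquiv).trans Desc.card⟩

theorem exists_descGroup_of_isImmediateDescendant {w : (ZMod p)ˣ}
    (hw : ∀ x, x ∈ Subgroup.zpowers w) {H : Type*} [Group H]
    (h : IsImmediateDescendant p (GroupD p) H) (hH : Nat.card H = p ^ 5) :
    ∃ i : DescLabel p, Nonempty (H ≃* DescGroup w i) := by
  obtain ⟨Q, ⟨e⟩⟩ := h.exists_desc_mulEquiv hH
  obtain ⟨i, ⟨f⟩⟩ := exists_descGroup_mulEquiv hw Q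
  exact ⟨i, ⟨e.trans f⟩⟩

theorem card_quotient_isoSetoid {w : (ZMod p)ˣ} (hw : ∀ x, x ∈ Subgroup.zpowers w) :
    Nat.card (Quotient (ImmDesc.isoSetoid.{u} p (GroupD p) (p ^ 5))) = p + 7 := by
  -- The listed groups live in the lowest universe and are lifted to the one where the classes are
  -- counted.
  let F (i : DescLabel p) : ImmDesc.{u} p (GroupD p) (p ^ 5) :=
    ⟨GrpCat.of (ULift.{u} (DescGroup w i)),
      (isImmediateDescendant_descGroup hw i).1.congr MulEquiv.ulift.symm,
      (Nat.card_congr Equiv.ulift).trans (isImmediateDescendant_descGroup hw i).2⟩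
  have hF : Function.Bijective fun i => Quotient.mk (ImmDesc.isoSetoid.{u} p (GroupD p) (p ^ 5)) (F i) := by
    constructor
    · intro i j hij
      obtain ⟨e⟩ := Quotient.exact hij
      exact eq_of_descGroup_mulEquiv hw ⟨MulEquiv.ulift.symm.trans (e.trans MulEquiv.ulift)⟩
    · intro q
      induction q using Quotient.inductionOn with
      | h H =>
        obtain ⟨i, ⟨e⟩⟩ := exists_descGroup_of_isImmediateDescendant hw H.2.1 H.2.2
        exact ⟨i, Quotient.sound ⟨MulEquiv.ulift.trans e.symm⟩⟩
  rw [← Nat.card_congr (Equiv.ofBijective _ hF), card_descLabel (by have := hp.out; omega)]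

end Count

theorem mainTheorem5 (p : ℕ) [Fact p.Prime] (hp : 3 < p) (w : (ZMod p)ˣ)
    (hw : ∀ x : (ZMod p)ˣ, x ∈ Subgroup.zpowers w) :
    -- every group of the list is an immediate descendant of `D_p` of order `p ^ 5`
    (∀ i : DescLabel p,
      IsImmediateDescendant p (GroupD p) (DescGroup w i) ∧ Nat.card (DescGroup w i) = p ^ 5) ∧
    -- the groups of the list are pairwise non-isomorphic
    (∀ i j : DescLabel p, Nonempty (DescGroup w i ≃* DescGroup w j) → i = j) ∧
    -- the list is complete
    (∀ (H : Type u) [Group H], IsImmediateDescendant p (GroupD p) H → Nat.card H = p ^ 5 →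
      ∃ i : DescLabel p, Nonempty (H ≃* DescGroup w i)) ∧
    -- the number of isomorphism classes
    Nat.card (Quotient (ImmDesc.isoSetoid.{u} p (GroupD p) (p ^ 5))) = p + 7 ∧
    -- the orbits of `GL(2, p)` on `2 × 2` matrices under `m ↦ det(g) g⁻¹ m g`
    (∀ m : Matrix (Fin 2) (Fin 2) (ZMod p),
      ∃! i : DescLabel p, ∃ g : GL (Fin 2) (ZMod p), m = detConj g (orbitRep w i)) ∧
    (Set.range fun m : Matrix (Fin 2) (Fin 2) (ZMod p) =>
      Set.range fun g : GL (Fin 2) (ZMod p) => detConj g m).ncard = p + 7 ∧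
    -- the groups of the list that depend on an invertible matrix correspond to its orbit
    (∀ (m : GL (Fin 2) (ZMod p)) (i : DescLabel p),
      Nonempty (MatrixGroup (m : Matrix (Fin 2) (Fin 2) (ZMod p)) ≃* DescGroup w i) ↔
        ∃ g : GL (Fin 2) (ZMod p),
          (m : Matrix (Fin 2) (Fin 2) (ZMod p)) = detConj g (orbitRep w i)) := by
  have : Fact (3 < p) := ⟨hp⟩
  exact ⟨isImmediateDescendant_descGroup hw, fun i j => eq_of_descGroup_mulEquiv hw,
    fun H _ => exists_descGroup_of_isImmediateDescendant hw, card_quotient_isoSetoid hw,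
    existsUnique_orbitRep hw hp, ncard_range_orbits hw hp, fun m i =>
      nonempty_matrixGroup_mulEquiv_descGroup_iff hw
        (m.isUnit.map Matrix.detMonoidHom).ne_zero i⟩
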